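/- Let $L_n(x)=\sum_{k=0}^n\binom nk\frac{(-x)^k}{k!}$ be the Laguerre polynomials and, for $\boldsymbol x\in\mathbb R^2$, let $\Psi_n(\boldsymbol x)=L_n(2\pi\|\boldsymbol x\|^2)e^{-\pi\|\boldsymbol x\|^2}$. For integers $a,b,c,d\ge 0$ put $$Q(a,b,c,d)=\int_0^\infty L_a(x/2)L_b(x/2)L_c(x/2)L_d(x/2)e^{-x}\,dx .$$ Let $\mathcal G=\ell^2(\mathbb Z_+^2)$, with $\langle\varphi,\psi\rangle=\sum_{a,b\ge0}\varphi(a,b)\overline{\psi(a,b)}$ and the corresponding norm, and let $$\mathcal Q\varphi(a,b)=\sum_{c,d\ge 0,\ c+d=a+b}\varphi(c,d)\,Q(a,b,c,d).$$ For $f\in L^2(\mathbb R^2)$ let $e^{it\Delta}f$ denote the solution of $\partial_tu=i\Delta u$ with $u(\cdot,0)=f$, that is, $\widehat{e^{it\Delta}f}(\boldsymbol y)=e^{-4\pi^2it\|\boldsymbol y\|^2}\widehat f(\boldsymbol y)$ with $\widehat f(\boldsymbol y)=\int f(\boldsymbol x)e^{-2\pi i\boldsymbol x\cdot\boldsymbol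 y}d\boldsymbol x$ (extended to $L^2$), regarded as a measurable function on $\mathbb R^2\times\mathbb R$. **Theorem.** 1. Every radial $f\in L^2(\mathbb R^2)$ has a unique expansion $f=\sum_{n\ge0}\alpha(n)\Psi_n$ convergent in $L^2(\mathbb R^2)$. With $\varphi(a,b)=\alpha(a)\alpha(b)$, one has $\varphi\in\mathcal G$, $e^{it\Delta}f\in L^4(\mathbb R^3,d\boldsymbol x\,dt)$, and $$\|e^{it\Delta}f\|_{L^4(\mathbb R^3,d\boldsymbol x\,dt)}^4=\tfrac1{16}\langle\varphi,\mathcal Q\varphi\rangle,\qquad \big(2^{-1/2}\|f\|_{L^2(\mathbb R^2)}\big)^4=\tfrac1{16}\|\varphi\|^2 .$$ 2. For every integer $S\ge0$ the matrix $\mathcal Q_S=[Q(a,S-a,c,S-c)]_{a,c=0,\dots,S}$ is positive semidefinite and doubly stochastic, and all of its entries are strictly positive. 3. $\mathcal Q$ is a bounded operator on $\mathcal G$ with $\|\mathcal Q\|_{\mathcal G\to\mathcal G}=1$. 4. A function $\varphi\in\mathcal G$ satisfies $\langle\varphi,\mathcal Q\varphi\rangle=\|\varphi\|^2$ if and only if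 $\varphi(a,b)=\varphi(c,d)$ whenever $a+b=c+d$. -/

import Mathlib

namespace LaguerreStrichartz

open MeasureTheory FourierTransform

noncomputable section

/-- The Euclidean plane. -/
abbrev Plane := EuclideanSpace ℝ (Fin 2)

/-- The complex Hilbert space of square integrable functions on the plane. -/
abbrev L2Plane : Type := Lp ℂ 2 (volume : Measure Plane)

/-- The space of square summable families of complex numbers indexed by pairs. -/
abbrev PairSeq : Type := lp (fun _ : ℕ × ℕ => ℂ) 2

/-- The multiplier by which the free Schrödinger flow acts on the frequency side, for the Fourier
transform with kernel `exp (-2 π i x · y)`. -/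
def flowMultiplier (t : ℝ) (y : Plane) : ℂ :=
  Complex.exp (-(4 * Real.pi ^ 2 * t * ‖y‖ ^ 2 : ℝ) * Complex.I)

theorem norm_flowMultiplier (t : ℝ) (y : Plane) : ‖flowMultiplier t y‖ = 1 := by
  unfold flowMultiplier
  rw [← Complex.ofReal_neg]
  exact Complex.norm_exp_ofReal_mul_I _

theorem memLp_flowMultiplier_mul (t : ℝ) (g : L2Plane) :
    MemLp (fun y => flowMultiplier t y * g y) 2 volume := by
  have hc : Continuous (flowMultiplier t) := by unfold flowMultiplier; fun_prop
  refine (Lp.memLp g).of_le (hc.aestronglyMeasurable.mul (Lp.aestronglyMeasurable g)) ?_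
  exact Filter.Eventually.of_forall fun y => by simp [norm_flowMultiplier]

/-- The free Schrödinger flow at time `t`: the solution at time `t` of `∂ₜ u = i Δ u` with initial
datum `f`, given by the `L²` Fourier transform. -/
def schrodingerFlow (t : ℝ) (f : L2Plane) : L2Plane :=
  𝓕⁻ ((memLp_flowMultiplier_mul t (𝓕 f)).toLp _)

/-- `u` is a measurable function on space-time that represents the Schrödinger evolution of `f`.
Any two such functions agree almost everywhere. -/
def IsEvolution (f : L2Plane) (u : ℝ × Plane → ℂ) : Prop :=
  AEStronglyMeasurable u (volume.prod volume) ∧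
    ∀ᵐ t : ℝ, (fun x => u (t, x)) =ᵐ[volume] schrodingerFlow t f

/-- `f` is almost everywhere a function of the distance to the origin. -/
def IsRadial (f : L2Plane) : Prop :=
  ∃ g : ℝ → ℂ, Measurable g ∧ ∀ᵐ x : Plane, f x = g ‖x‖

/-- The Laguerre polynomials with parameter `0`. -/
def laguerre (n : ℕ) (x : ℝ) : ℝ :=
  ∑ k ∈ Finset.range (n + 1), (-1) ^ k * (n.choose k : ℝ) / (k.factorial : ℝ) * x ^ k

/-- The radial functions `L_n (2 π |x|²) exp (-π |x|²)` on the plane. -/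
def laguerreFun (n : ℕ) (x : Plane) : ℝ :=
  laguerre n (2 * Real.pi * ‖x‖ ^ 2) * Real.exp (-Real.pi * ‖x‖ ^ 2)

/-- The expansion `f = ∑ α n Ψ_n`, convergent in `L²`. -/
def HasLaguerreExpansion (f : L2Plane) (α : ℕ → ℂ) : Prop :=
  Filter.Tendsto
    (fun N : ℕ => eLpNorm
      (fun x => f x - ∑ n ∈ Finset.range N, α n * (laguerreFun n x : ℂ)) 2 volume)
    Filter.atTop (nhds 0)

/-- The coefficients `Q(a,b,c,d)`. -/
def coeffQ (a b c d : ℕ) : ℝ :=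
  ∫ x in Set.Ioi (0 : ℝ),
    laguerre a (x / 2) * laguerre b (x / 2) * laguerre c (x / 2) * laguerre d (x / 2)
      * Real.exp (-x)

/-- The action of `Q` on families indexed by pairs, as a finite sum in each entry. -/
def applyQ (φ : ℕ × ℕ → ℂ) (p : ℕ × ℕ) : ℂ :=
  ∑ q ∈ Finset.HasAntidiagonal.antidiagonal (p.1 + p.2), φ q * (coeffQ p.1 p.2 q.1 q.2 : ℂ)

/-- The block `Q_S`. -/
def blockQ (S : ℕ) : Matrix (Fin (S + 1)) (Fin (S + 1)) ℝ :=
  Matrix.of fun a c => coeffQ a (S - a) c (S - c)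

end

end LaguerreStrichartz

open LaguerreStrichartz MeasureTheory

/-!
Let `s = 4 π t` and let `w = (1 - i s) / (1 + i s)`, a unimodular number. The free flow maps the
radial function `laguerreFun n` to

  `(1 + i s)⁻¹ * w ^ n * L_n (2 π |x|² / (1 + s²)) * exp (-π |x|² / (1 + i s))`.

The generating functions in `n` of both families are Gaussians, and the flow of a Gaussian is
computed on the Fourier side (`flowIsometry_tsum_modeLp`); comparing the coefficients of `r ^ n`
gives the formula for each mode (`flowIsometry_modeLp`). In the integral over space-time of a
product of two modes and the conjugates of two others, the space integral is
`coeffQ a b c d / 4` times a power of `w` over `1 + s²`. Under `s = tan θ` one has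
`w = exp (-2 i θ)`, so that the time integral vanishes unless `a + b = c + d`
(`integral_spacetimeMode_product`). This is the identity for the `L⁴` norm on finite sums. Since the
operator with kernel `coeffQ` is a contraction, the identity bounds the `L⁴` norm by the `L²` norm,
and it passes to limits (`norm_tsum_modeL4_pow`, `isEvolution_tsum_modeL4`).

The modes span the radial functions because their generating function at suitable real parameters
gives the Gaussians `exp (-π (k + 1) |x|²)`, which are the positive powers of the single function
`exp (-π |x|²)`; the Weierstrass approximation theorem on `[0, 1]` does the rest
(`mem_modeSpan_of_isRadial`).

For the blocks, put `S = a + b`. Then `L_a (x / 2) * L_b (x / 2) = ∑ k ≤ S, A a k * L_k x`, where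
`2 ^ S * A a k` is the product of two Krawtchouk numbers which, by duality, differ by a positive
factor (`laguerre_mul_laguerre`, `choose_mul_krawtchouk`). Hence the matrix `A` is symmetric and
nonnegative, its column `k = 0` is positive, and evaluation at `x = 0` shows that its rows sum to
one. As the `L_k` are orthonormal for `exp (-x) dx`, the block is `A * Aᵀ`
(`blockQ_eq_mul_conjTranspose`), so it is positive semidefinite, doubly stochastic and entrywise
positive. For a symmetric doubly stochastic matrix the quadratic form of its difference to the
identity is the Dirichlet form `1 / 2 * ∑ Q p q * |φ p - φ q|²` (`sum_norm_sq_sub_sum_applyQ`),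
which by positivity of the entries vanishes only on constants.
-/

namespace LaguerreStrichartz

open MeasureTheory Polynomial Filter Topology ComplexConjugate FourierTransform

noncomputable section

/-! ### Krawtchouk numbers and products of Laguerre polynomials -/

/-- The Laguerre polynomial as a formal polynomial. -/
def laguerrePoly (n : ℕ) : ℝ[X] :=
  ∑ k ∈ Finset.range (n + 1), monomial k ((-1) ^ k * (n.choose k : ℝ) / (k.factorial : ℝ))

theorem eval_laguerrePoly (n : ℕ) (x : ℝ) : (laguerrePoly n).eval x = laguerre n x := by
  simp [laguerrePoly, laguerre, eval_finsetSum]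

theorem coeff_laguerrePoly (n k : ℕ) :
    (laguerrePoly n).coeff k = (-1) ^ k * (n.choose k : ℝ) / (k.factorial : ℝ) := by
  rw [laguerrePoly, finsetSum_coeff]
  simp only [coeff_monomial, Finset.sum_ite_eq', Finset.mem_range]
  split_ifs with h
  · rfl
  · rw [Nat.choose_eq_zero_of_lt (by omega)]
    simp

/-- The Krawtchouk number: the coefficient of `U ^ k * V ^ (S - k)` in
`(U + V) ^ a * (U - V) ^ (S - a)`. -/
def krawtchouk (S a k : ℕ) : ℝ := ((X + 1) ^ a * (X - 1) ^ (S - a) : ℝ[X]).coeff k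

/-- The defining expansion of the Krawtchouk numbers, for arbitrary elements `U` and `V` of a
commutative algebra; it follows by homogenizing the case `V = 1`. -/
theorem krawtchouk_expansion {A : Type*} [CommRing A] [Algebra ℝ A] {S a : ℕ} (ha : a ≤ S)
    (U V : A) :
    (U + V) ^ a * (U - V) ^ (S - a)
      = ∑ k ∈ Finset.range (S + 1), krawtchouk S a k • (U ^ k * V ^ (S - k)) := by
  have h : ((X + 1) ^ a * (X - 1) ^ (S - a) : ℝ[X]).homogenize S
      = (MvPolynomial.X 0 + MvPolynomial.X 1) ^ a *
        (MvPolynomial.X 0 - MvPolynomial.X 1) ^ (S - a) := by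
    apply homogenize_eq_of_isHomogeneous
    · have h1 := ((MvPolynomial.isHomogeneous_X ℝ (0 : Fin 2)).add
        (MvPolynomial.isHomogeneous_X ℝ (1 : Fin 2))).pow a
      have h2 := ((MvPolynomial.isHomogeneous_X ℝ (0 : Fin 2)).sub
        (MvPolynomial.isHomogeneous_X ℝ (1 : Fin 2))).pow (S - a)
      have h3 := h1.mul h2
      rwa [one_mul, one_mul, Nat.add_sub_cancel' ha] at h3
    · simp
  have h4 := congrArg (MvPolynomial.aeval ![U, V]) h
  simp only [map_mul, map_pow, map_add, map_sub, MvPolynomial.aeval_X, Matrix.cons_val_zero,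
    Matrix.cons_val_one] at h4
  rw [← h4, homogenize, map_sum, Finset.Nat.sum_antidiagonal_eq_sum_range_succ_mk]
  refine Finset.sum_congr rfl fun k _ => ?_
  rw [MvPolynomial.aeval_monomial, Finsupp.update_eq_add_single (by simp),
    Finsupp.prod_add_index' (by simp) (by simp [pow_add])]
  simp [krawtchouk, Algebra.smul_def]

/-- Krawtchouk duality: the matrix of the linear substitution `(U, V) ↦ (U + V, U - V)` on binary
forms is symmetric for the binomial inner product. -/
theorem choose_mul_krawtchouk {S a k : ℕ} (ha : a ≤ S) (hk : k ≤ S) :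
    (S.choose k : ℝ) * krawtchouk S k a = S.choose a * krawtchouk S a k := by
  -- both sides are the coefficient of `X ^ a * T ^ k` in
  -- `(T * (X + 1) + (X - 1)) ^ S = (X * (T + 1) + (T - 1)) ^ S`
  have key : ((X * C (X + 1) + C (X - 1)) ^ S : ℝ[X][X])
      = (C X * (X + 1) + (X - 1)) ^ S := by
    congr 1
    simp only [map_add, map_sub, map_one]
    ring
  rw [add_pow, add_pow] at key
  have h := congrArg (fun p : ℝ[X][X] => (p.coeff k).coeff a) key
  have hl : ∀ m, (((X * C (X + 1)) ^ m * C (X - 1) ^ (S - m) * (S.choose m : ℝ[X][X])).coeff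
      k).coeff a = if m = k then (S.choose k : ℝ) * krawtchouk S k a else 0 := by
    intro m
    have : ((X * C (X + 1)) ^ m * C (X - 1) ^ (S - m) * (S.choose m : ℝ[X][X]))
        = C ((X + 1) ^ m * (X - 1) ^ (S - m) * C (S.choose m : ℝ)) * X ^ m := by
      simp only [map_mul, map_pow, map_natCast, mul_pow]
      ring
    rw [this, coeff_C_mul_X_pow]
    by_cases h : k = m
    · subst h; simp [krawtchouk, mul_comm]
    · simp [h, Ne.symm h]
  have hr : ∀ m, (((C X * (X + 1)) ^ m * (X - 1) ^ (S - m) * (S.choose m : ℝ[X][X])).coeff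
      k).coeff a = if m = a then (S.choose a : ℝ) * krawtchouk S a k else 0 := by
    intro m
    have : ((C X * (X + 1)) ^ m * (X - 1) ^ (S - m) * (S.choose m : ℝ[X][X]))
        = C (X ^ m) * ((X + 1) ^ m * (X - 1) ^ (S - m) * C (S.choose m : ℝ)).map C := by
      simp only [Polynomial.map_mul, Polynomial.map_pow, Polynomial.map_add, Polynomial.map_sub,
        map_natCast, Polynomial.map_natCast, map_X, Polynomial.map_one, mul_pow, map_pow]
      ring
    rw [this, coeff_C_mul, coeff_map, mul_comm, coeff_C_mul, coeff_X_pow]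
    by_cases h : a = m
    · subst h; simp [krawtchouk, mul_comm]
    · simp [h, Ne.symm h]
  simp only [finsetSum_coeff, hl, hr] at h
  simpa [Finset.mem_range, Nat.lt_succ_of_le ha, Nat.lt_succ_of_le hk] using h

/-- The coefficient of `x ^ m` in the product formula for Laguerre polynomials, up to the factor
`(-1) ^ m / m !`. -/
theorem sum_antidiagonal_choose_eq_krawtchouk {S a : ℕ} (ha : a ≤ S) (m : ℕ) :
    ∑ p ∈ Finset.HasAntidiagonal.antidiagonal m,
        ((a.choose p.1 : ℝ) * ((S - a).choose p.2) * m.choose p.1)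
      = ∑ k ∈ Finset.range (S + 1),
          krawtchouk S a k * krawtchouk S k a * k.choose m * 2 ^ m / 2 ^ S := by
  -- with the outer variable `T` and `U = T + (X + 1) / 2`, `V = (X - 1) / 2`, the expansion reads
  -- `(X + T) ^ a * (1 + T) ^ (S - a) = ∑ k, krawtchouk S a k • (U ^ k * V ^ (S - k))`
  have h := krawtchouk_expansion ha (X + C (C (1 / 2) * (X + 1)) : ℝ[X][X])
    (C (C (1 / 2) * (X - 1)))
  have e1 : (X + C (C (1 / 2) * (X + 1)) + C (C (1 / 2) * (X - 1)) : ℝ[X][X]) = X + C X := by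
    rw [add_assoc, ← C_add, ← mul_add]
    have : (X + 1 + (X - 1) : ℝ[X]) = C 2 * X := by
      rw [show (C 2 : ℝ[X]) = 2 from rfl]; ring
    rw [this, ← mul_assoc, ← C_mul]
    norm_num
  have e2 : (X + C (C (1 / 2) * (X + 1)) - C (C (1 / 2) * (X - 1)) : ℝ[X][X]) = X + 1 := by
    rw [add_sub_assoc, ← C_sub, ← mul_sub]
    have : (X + 1 - (X - 1) : ℝ[X]) = C 2 := by
      rw [show (C 2 : ℝ[X]) = 2 from rfl]; ring
    rw [this, ← C_mul]
    norm_num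
  rw [e1, e2] at h
  -- take the coefficient of `T ^ m`, restore the degree with `(X + 1) ^ m`, and take the
  -- coefficient of `X ^ a`
  have h2 := congrArg (fun p : ℝ[X][X] => ((X + 1) ^ m * p.coeff m).coeff a) h
  simp only [coeff_mul (_ ^ a), coeff_X_add_C_pow, coeff_X_add_one_pow, finsetSum_coeff,
    Finset.mul_sum] at h2
  refine Eq.trans (Finset.sum_congr rfl fun p hp => ?_) (h2.trans
    (Finset.sum_congr rfl fun k hk => ?_))
  · have : ((X + 1) ^ m * (X ^ (a - p.1) * (a.choose p.1 : ℝ[X]) * ((S - a).choose p.2 : ℝ[X])))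
        = C ((a.choose p.1 : ℝ) * (S - a).choose p.2) * ((X + 1) ^ m * X ^ (a - p.1)) := by
      simp only [map_mul, map_natCast]; ring
    rw [this, coeff_C_mul, coeff_mul_X_pow']
    by_cases h : p.1 ≤ a
    · rw [if_pos (by omega), coeff_X_add_one_pow, Nat.sub_sub_self h]
    · simp [Nat.choose_eq_zero_of_lt (not_le.mp h)]
  · rw [coeff_smul, ← C_pow, coeff_mul_C, coeff_X_add_C_pow]
    have hk' : k ≤ S := by simpa [Nat.lt_succ_iff] using hk
    by_cases h : m ≤ k
    · have : (X + 1 : ℝ[X]) ^ m * krawtchouk S a k •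
          ((C (1 / 2) * (X + 1)) ^ (k - m) * (k.choose m : ℝ[X]) * (C (1 / 2) * (X - 1)) ^ (S - k))
          = C (krawtchouk S a k * (1 / 2) ^ (k - m) * k.choose m * (1 / 2) ^ (S - k)) *
            ((X + 1) ^ k * (X - 1) ^ (S - k)) := by
        rw [smul_eq_C_mul]
        simp only [mul_pow, map_mul, map_natCast, map_pow]
        rw [show (X + 1 : ℝ[X]) ^ k = (X + 1) ^ m * (X + 1) ^ (k - m) by
          rw [← pow_add, Nat.add_sub_cancel' h]]
        ring
      rw [this, coeff_C_mul]
      change _ * krawtchouk S k a = _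
      have h3 : (2 : ℝ) ^ S = 2 ^ m * 2 ^ (k - m) * 2 ^ (S - k) := by
        rw [← pow_add, ← pow_add]; congr 1; omega
      rw [h3, one_div, inv_pow, inv_pow]
      field_simp
    · simp [Nat.choose_eq_zero_of_lt (not_le.mp h)]

/-- The connection coefficients of `laguerre a x * laguerre (S - a) x` in the basis
`laguerre k (2 * x)`. -/
def connection (S a k : ℕ) : ℝ := krawtchouk S a k * krawtchouk S k a / 2 ^ S

theorem connection_comm (S a k : ℕ) : connection S a k = connection S k a := by
  rw [connection, connection, mul_comm (krawtchouk S a k)]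

/-- By duality `krawtchouk S k a` is a positive multiple of `krawtchouk S a k`, so that the
connection coefficient is a nonnegative multiple of a square. -/
theorem connection_nonneg {S a k : ℕ} (ha : a ≤ S) (hk : k ≤ S) : 0 ≤ connection S a k := by
  have h := choose_mul_krawtchouk ha hk
  have h1 : (0 : ℝ) < S.choose k := by exact_mod_cast Nat.choose_pos hk
  have h2 : krawtchouk S k a = S.choose a * krawtchouk S a k / S.choose k := by
    rw [eq_div_iff h1.ne', mul_comm, h]
  rw [connection, h2]
  have : krawtchouk S a k * (S.choose a * krawtchouk S a k / S.choose k) / 2 ^ S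
    = S.choose a / S.choose k / 2 ^ S * krawtchouk S a k ^ 2 := by ring
  rw [this]
  positivity

theorem connection_zero_pos {S a : ℕ} (ha : a ≤ S) : 0 < connection S a 0 := by
  have h := choose_mul_krawtchouk ha (Nat.zero_le S)
  have h0 : krawtchouk S a 0 ^ 2 = 1 := by
    rw [krawtchouk, coeff_zero_eq_eval_zero]
    simp [← pow_mul]
  have h2 : krawtchouk S 0 a = S.choose a * krawtchouk S a 0 := by simpa using h
  have h1 : (0 : ℝ) < S.choose a := by exact_mod_cast Nat.choose_pos ha
  rw [connection, h2, show krawtchouk S a 0 * (S.choose a * krawtchouk S a 0)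
    = S.choose a * krawtchouk S a 0 ^ 2 by ring, h0]
  positivity

/-- The product of two Laguerre polynomials at `x` is a combination with nonnegative coefficients
of Laguerre polynomials at `2 * x`. -/
theorem laguerre_mul_laguerre {S a : ℕ} (ha : a ≤ S) (x : ℝ) :
    laguerre a x * laguerre (S - a) x
      = ∑ k ∈ Finset.range (S + 1), connection S a k * laguerre k (2 * x) := by
  have h : laguerrePoly a * laguerrePoly (S - a)
      = ∑ k ∈ Finset.range (S + 1), C (connection S a k) * (laguerrePoly k).comp (C 2 * X) := by
    ext m
    rw [coeff_mul, finsetSum_coeff]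
    simp only [coeff_C_mul, comp_C_mul_X_coeff, coeff_laguerrePoly]
    have hm : (m.factorial : ℝ) ≠ 0 := by exact_mod_cast m.factorial_ne_zero
    have h1 := congrArg (fun t : ℝ => (-1) ^ m / m.factorial * t)
      (sum_antidiagonal_choose_eq_krawtchouk ha m)
    simp only [Finset.mul_sum] at h1
    refine Eq.trans (Finset.sum_congr rfl fun p hp => ?_) (h1.trans
      (Finset.sum_congr rfl fun k hk => ?_))
    · rw [Finset.HasAntidiagonal.mem_antidiagonal] at hp
      have h2 : (m.choose p.1 : ℝ) * p.1.factorial * p.2.factorial = m.factorial := by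
        have := Nat.choose_mul_factorial_mul_factorial (show p.1 ≤ m by omega)
        rw [show m - p.1 = p.2 by omega] at this
        exact_mod_cast this
      have h3 : (p.1.factorial : ℝ) ≠ 0 := by exact_mod_cast p.1.factorial_ne_zero
      have h4 : (p.2.factorial : ℝ) ≠ 0 := by exact_mod_cast p.2.factorial_ne_zero
      rw [← h2, ← hp, pow_add] at *
      have h5 : ((p.1 + p.2).choose p.1 : ℝ) ≠ 0 := by
        exact_mod_cast (Nat.choose_pos (by omega)).ne'
      field_simp
    · rw [connection]
      ring
  have := congrArg (eval x) h
  simpa [eval_finsetSum, eval_comp, eval_laguerrePoly] using this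

theorem laguerre_zero_right (n : ℕ) : laguerre n 0 = 1 := by
  rw [← eval_laguerrePoly, ← coeff_zero_eq_eval_zero, coeff_laguerrePoly]
  simp

theorem sum_connection {S a : ℕ} (ha : a ≤ S) :
    ∑ k ∈ Finset.range (S + 1), connection S a k = 1 := by
  have := laguerre_mul_laguerre ha 0
  simpa [laguerre_zero_right] using this.symm

/-! ### Orthogonality of the Laguerre polynomials and the blocks -/

theorem integrableOn_pow_mul_exp_neg (k : ℕ) :
    IntegrableOn (fun x : ℝ => x ^ k * Real.exp (-x)) (Set.Ioi 0) := by
  have := Real.GammaIntegral_convergent (s := (k : ℝ) + 1) (by positivity)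
  refine this.congr_fun (fun x _ => ?_) measurableSet_Ioi
  simp [mul_comm]

theorem integral_pow_mul_exp_neg (k : ℕ) :
    ∫ x in Set.Ioi (0 : ℝ), x ^ k * Real.exp (-x) = k.factorial := by
  rw [← Real.Gamma_nat_eq_factorial, Real.Gamma_eq_integral (by positivity)]
  refine setIntegral_congr_fun measurableSet_Ioi fun x _ => ?_
  simp [mul_comm]

theorem integrableOn_eval_mul_exp_neg (p : ℝ[X]) :
    IntegrableOn (fun x : ℝ => p.eval x * Real.exp (-x)) (Set.Ioi 0) := by
  simp only [eval_eq_sum_range, Finset.sum_mul, mul_assoc]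
  exact integrable_finsetSum _ fun k _ => (integrableOn_pow_mul_exp_neg k).const_mul _

theorem sum_alternating_choose_mul_choose (n j : ℕ) :
    ∑ k ∈ Finset.range (n + 1), (-1 : ℝ) ^ k * n.choose k * (j + k).choose j
      = (-1) ^ n * j.choose n := by
  -- compare the coefficients of `X ^ j` in `(1 + X) ^ j * (1 - (1 + X)) ^ n`
  have h : ((X + 1) ^ j * (-(X + 1) + 1) ^ n : ℝ[X]) = (X + 1) ^ j * (C ((-1) ^ n) * X ^ n) := by
    rw [map_pow, ← mul_pow]
    simp
  rw [add_pow (-(X + 1 : ℝ[X])), Finset.mul_sum] at h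
  have h2 := congrArg (fun p : ℝ[X] => p.coeff j) h
  simp only [finsetSum_coeff] at h2
  refine (Finset.sum_congr rfl fun k _ => ?_).trans (h2.trans ?_)
  · have : ((X + 1) ^ j * ((-(X + 1)) ^ k * 1 ^ (n - k) * (n.choose k : ℝ[X])))
        = C ((-1) ^ k * (n.choose k : ℝ)) * (X + 1) ^ (j + k) := by
      rw [neg_pow]
      simp only [map_mul, map_pow, map_natCast, map_neg, map_one]
      ring
    rw [this, coeff_C_mul, coeff_X_add_one_pow]
  · rw [mul_left_comm, coeff_C_mul, coeff_mul_X_pow']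
    split_ifs with hn
    · rw [coeff_X_add_one_pow, Nat.choose_symm hn]
    · rw [Nat.choose_eq_zero_of_lt (not_le.mp hn)]
      simp

theorem integral_pow_mul_laguerre (j n : ℕ) :
    ∫ x in Set.Ioi (0 : ℝ), x ^ j * laguerre n x * Real.exp (-x)
      = j.factorial * ((-1) ^ n * j.choose n) := by
  have : ∀ x : ℝ, x ^ j * laguerre n x * Real.exp (-x) = ∑ k ∈ Finset.range (n + 1),
      (-1) ^ k * (n.choose k : ℝ) / (k.factorial : ℝ) * (x ^ (j + k) * Real.exp (-x)) := by
    intro x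
    rw [laguerre, Finset.mul_sum, Finset.sum_mul]
    refine Finset.sum_congr rfl fun k _ => ?_
    rw [pow_add]
    ring
  simp only [this]
  rw [integral_finsetSum _ fun k _ => (integrableOn_pow_mul_exp_neg _).const_mul _,
    ← sum_alternating_choose_mul_choose, Finset.mul_sum]
  refine Finset.sum_congr rfl fun k _ => ?_
  rw [integral_const_mul, integral_pow_mul_exp_neg,
    ← Nat.choose_mul_factorial_mul_factorial (Nat.le_add_right j k), Nat.add_sub_cancel_left]
  have : (k.factorial : ℝ) ≠ 0 := by exact_mod_cast k.factorial_ne_zero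
  push_cast
  field_simp

theorem integrableOn_laguerre_mul_laguerre (m n : ℕ) :
    IntegrableOn (fun x : ℝ => laguerre m x * laguerre n x * Real.exp (-x)) (Set.Ioi 0) := by
  have := integrableOn_eval_mul_exp_neg (laguerrePoly m * laguerrePoly n)
  simpa only [eval_mul, eval_laguerrePoly] using this

theorem integral_laguerre_mul_laguerre (m n : ℕ) :
    ∫ x in Set.Ioi (0 : ℝ), laguerre m x * laguerre n x * Real.exp (-x)
      = if m = n then 1 else 0 := by
  wlog hmn : m ≤ n generalizing m n
  · simp only [eq_comm (a := m), mul_comm (laguerre m _)]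
    exact this n m (le_of_not_ge hmn)
  have : ∀ x : ℝ, laguerre m x * laguerre n x * Real.exp (-x) = ∑ j ∈ Finset.range (m + 1),
      (-1) ^ j * (m.choose j : ℝ) / (j.factorial : ℝ) * (x ^ j * laguerre n x * Real.exp (-x)) := by
    intro x
    conv_lhs => rw [laguerre, Finset.sum_mul, Finset.sum_mul]
    refine Finset.sum_congr rfl fun k _ => ?_
    ring
  simp only [this]
  have hint : ∀ j : ℕ, IntegrableOn (fun x : ℝ => x ^ j * laguerre n x * Real.exp (-x))
      (Set.Ioi 0) := by
    intro j
    have := integrableOn_eval_mul_exp_neg (X ^ j * laguerrePoly n)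
    simpa only [eval_mul, eval_laguerrePoly, eval_pow, eval_X] using this
  rw [integral_finsetSum _ fun k _ => (hint _).const_mul _]
  simp only [integral_const_mul, integral_pow_mul_laguerre]
  rw [Finset.sum_eq_single m]
  · have : (m.factorial : ℝ) ≠ 0 := by exact_mod_cast m.factorial_ne_zero
    split_ifs with h
    · subst h
      field_simp
      simp [← pow_mul]
    · rw [Nat.choose_eq_zero_of_lt (lt_of_le_of_ne hmn h)]
      simp
  · intro j hj hjm
    rw [Finset.mem_range] at hj
    rw [Nat.choose_eq_zero_of_lt (by omega : j < n)]
    simp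
  · simp

/-- Both pairs of factors are expanded in the orthonormal system `laguerre k`. -/
theorem coeffQ_eq_sum_connection {S a c : ℕ} (ha : a ≤ S) (hc : c ≤ S) :
    coeffQ a (S - a) c (S - c)
      = ∑ k ∈ Finset.range (S + 1), connection S a k * connection S c k := by
  have : ∀ x : ℝ, laguerre a (x / 2) * laguerre (S - a) (x / 2) * laguerre c (x / 2) *
        laguerre (S - c) (x / 2) * Real.exp (-x)
      = ∑ k ∈ Finset.range (S + 1), ∑ l ∈ Finset.range (S + 1),
        connection S a k * connection S c l * (laguerre k x * laguerre l x * Real.exp (-x)) := by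
    intro x
    rw [mul_assoc _ (laguerre c _), laguerre_mul_laguerre ha, laguerre_mul_laguerre hc,
      Finset.sum_mul_sum, Finset.sum_mul]
    refine Finset.sum_congr rfl fun k _ => ?_
    rw [Finset.sum_mul]
    refine Finset.sum_congr rfl fun l _ => ?_
    rw [mul_div_cancel₀ x two_ne_zero]
    ring
  simp only [coeffQ, this]
  rw [integral_finsetSum _ fun k _ => integrable_finsetSum _ fun l _ =>
    (integrableOn_laguerre_mul_laguerre k l).const_mul _]
  refine Finset.sum_congr rfl fun k hk => ?_
  rw [integral_finsetSum _ fun l _ => (integrableOn_laguerre_mul_laguerre k l).const_mul _]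
  simp only [integral_const_mul, integral_laguerre_mul_laguerre]
  simp only [mul_ite, mul_one, mul_zero, Finset.sum_ite_eq, if_pos hk]

theorem coeffQ_pos {S a c : ℕ} (ha : a ≤ S) (hc : c ≤ S) : 0 < coeffQ a (S - a) c (S - c) := by
  rw [coeffQ_eq_sum_connection ha hc]
  refine Finset.sum_pos' (fun k hk => ?_) ⟨0, by simp, ?_⟩
  · rw [Finset.mem_range, Nat.lt_succ_iff] at hk
    exact mul_nonneg (connection_nonneg ha hk) (connection_nonneg hc hk)
  · exact mul_pos (connection_zero_pos ha) (connection_zero_pos hc)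

theorem coeffQ_comm (a b c d : ℕ) : coeffQ a b c d = coeffQ c d a b := by
  simp only [coeffQ]
  congr 1
  ext x
  ring

theorem sum_coeffQ {S a : ℕ} (ha : a ≤ S) :
    ∑ c ∈ Finset.range (S + 1), coeffQ a (S - a) c (S - c) = 1 := by
  have h : ∀ c ∈ Finset.range (S + 1), coeffQ a (S - a) c (S - c)
      = ∑ k ∈ Finset.range (S + 1), connection S a k * connection S c k := fun c hc =>
    coeffQ_eq_sum_connection ha (Nat.lt_succ_iff.mp (Finset.mem_range.mp hc))
  rw [Finset.sum_congr rfl h, Finset.sum_comm]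
  simp only [← Finset.mul_sum]
  refine (Finset.sum_congr rfl fun k hk => ?_).trans (sum_connection ha)
  simp only [connection_comm S _ k]
  rw [sum_connection (Nat.lt_succ_iff.mp (Finset.mem_range.mp hk)), mul_one,
    connection_comm]

theorem blockQ_apply (S : ℕ) (a c : Fin (S + 1)) :
    blockQ S a c = coeffQ a (S - a) c (S - c) := rfl

/-- The block is the Gram matrix of the products `laguerre a x * laguerre (S - a) x`, expressed in
an orthonormal system. -/
theorem blockQ_eq_mul_conjTranspose (S : ℕ) :
    blockQ S = (Matrix.of fun a k : Fin (S + 1) => connection S a k) *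
      (Matrix.of fun a k : Fin (S + 1) => connection S a k).conjTranspose := by
  ext a c
  rw [blockQ_apply, coeffQ_eq_sum_connection (Nat.lt_succ_iff.mp a.2) (Nat.lt_succ_iff.mp c.2),
    Matrix.mul_apply, Finset.sum_range]
  rfl

theorem blockQ_posSemidef (S : ℕ) : (blockQ S).PosSemidef := by
  rw [blockQ_eq_mul_conjTranspose]
  exact Matrix.posSemidef_self_mul_conjTranspose _

theorem blockQ_pos (S : ℕ) (a c : Fin (S + 1)) : 0 < blockQ S a c :=
  coeffQ_pos (Nat.lt_succ_iff.mp a.2) (Nat.lt_succ_iff.mp c.2)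

theorem blockQ_mem_doublyStochastic (S : ℕ) :
    blockQ S ∈ doublyStochastic ℝ (Fin (S + 1)) := by
  rw [mem_doublyStochastic_iff_sum]
  have hrow : ∀ a, ∑ c, blockQ S a c = 1 := by
    intro a
    have := sum_coeffQ (Nat.lt_succ_iff.mp a.2)
    rw [Finset.sum_range] at this
    exact this
  refine ⟨fun a c => (blockQ_pos S a c).le, hrow, fun c => ?_⟩
  rw [← hrow c]
  exact Finset.sum_congr rfl fun a _ => coeffQ_comm _ _ _ _

/-! ### The operator on square summable families -/

theorem coeffQ_pos_of_mem {S : ℕ} {p q : ℕ × ℕ} (hp : p ∈ Finset.HasAntidiagonal.antidiagonal S)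
    (hq : q ∈ Finset.HasAntidiagonal.antidiagonal S) : 0 < coeffQ p.1 p.2 q.1 q.2 := by
  rw [Finset.HasAntidiagonal.mem_antidiagonal] at hp hq
  have := coeffQ_pos (show p.1 ≤ S by omega) (show q.1 ≤ S by omega)
  rwa [show S - p.1 = p.2 by omega, show S - q.1 = q.2 by omega] at this

theorem sum_antidiagonal_coeffQ {S : ℕ} {p : ℕ × ℕ}
    (hp : p ∈ Finset.HasAntidiagonal.antidiagonal S) :
    ∑ q ∈ Finset.HasAntidiagonal.antidiagonal S, coeffQ p.1 p.2 q.1 q.2 = 1 := by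
  rw [Finset.HasAntidiagonal.mem_antidiagonal] at hp
  rw [Finset.Nat.sum_antidiagonal_eq_sum_range_succ_mk, ← sum_coeffQ (show p.1 ≤ S by omega),
    show S - p.1 = p.2 by omega]

theorem applyQ_of_mem {S : ℕ} {p : ℕ × ℕ} (hp : p ∈ Finset.HasAntidiagonal.antidiagonal S)
    (φ : ℕ × ℕ → ℂ) :
    applyQ φ p = ∑ q ∈ Finset.HasAntidiagonal.antidiagonal S,
      φ q * (coeffQ p.1 p.2 q.1 q.2 : ℂ) := by
  rw [Finset.HasAntidiagonal.mem_antidiagonal] at hp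
  rw [applyQ, hp]

theorem hasSum_antidiagonal {E : Type*} [NormedAddCommGroup E] {F : ℕ × ℕ → E} {s : E}
    (h : HasSum F s) :
    HasSum (fun S => ∑ p ∈ Finset.HasAntidiagonal.antidiagonal S, F p) s := by
  rw [← Finset.HasAntidiagonal.sigmaAntidiagonalEquivProd.hasSum_iff] at h
  refine h.sigma fun S => ?_
  have := hasSum_fintype fun p : Finset.HasAntidiagonal.antidiagonal S => F p
  rwa [Finset.univ_eq_attach, Finset.sum_attach _ F] at this

theorem summable_of_summable_antidiagonal {F : ℕ × ℕ → ℝ} (hF : ∀ p, 0 ≤ F p)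
    (h : Summable fun S => ∑ p ∈ Finset.HasAntidiagonal.antidiagonal S, F p) : Summable F := by
  rw [← Finset.HasAntidiagonal.sigmaAntidiagonalEquivProd.summable_iff]
  refine (summable_sigma_of_nonneg fun _ => hF _).mpr
    ⟨fun S => Summable.of_finite, h.congr fun S => ?_⟩
  rw [tsum_fintype, Finset.univ_eq_attach]
  exact (Finset.sum_attach _ F).symm

/-- On each antidiagonal the operator is doubly stochastic, hence a contraction. -/
theorem sum_norm_applyQ_sq_le (φ : ℕ × ℕ → ℂ) (S : ℕ) :
    ∑ p ∈ Finset.HasAntidiagonal.antidiagonal S, ‖applyQ φ p‖ ^ 2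
      ≤ ∑ p ∈ Finset.HasAntidiagonal.antidiagonal S, ‖φ p‖ ^ 2 := by
  have h1 : ∀ p ∈ Finset.HasAntidiagonal.antidiagonal S, ‖applyQ φ p‖ ^ 2
      ≤ ∑ q ∈ Finset.HasAntidiagonal.antidiagonal S, coeffQ q.1 q.2 p.1 p.2 * ‖φ q‖ ^ 2 := by
    intro p hp
    have h2 : ‖applyQ φ p‖ ≤ ∑ q ∈ Finset.HasAntidiagonal.antidiagonal S,
        coeffQ p.1 p.2 q.1 q.2 * ‖φ q‖ := by
      rw [applyQ_of_mem hp]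
      refine (norm_sum_le _ _).trans (Finset.sum_le_sum fun q hq => le_of_eq ?_)
      rw [norm_mul, Complex.norm_real, Real.norm_of_nonneg (coeffQ_pos_of_mem hp hq).le, mul_comm]
    refine (pow_le_pow_left₀ (norm_nonneg _) h2 2).trans ?_
    refine (Finset.sum_sq_le_sum_mul_sum_of_sq_le_mul _
      (f := fun q => coeffQ p.1 p.2 q.1 q.2) (g := fun q => coeffQ q.1 q.2 p.1 p.2 * ‖φ q‖ ^ 2)
      (fun q hq => (coeffQ_pos_of_mem hp hq).le)
      (fun q hq => mul_nonneg (coeffQ_pos_of_mem hq hp).le (sq_nonneg _)) fun q _ => ?_).trans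
      (le_of_eq ?_)
    · rw [coeffQ_comm q.1]
      exact le_of_eq (by ring)
    · rw [sum_antidiagonal_coeffQ hp, one_mul]
  refine (Finset.sum_le_sum h1).trans (le_of_eq ?_)
  rw [Finset.sum_comm]
  refine Finset.sum_congr rfl fun q hq => ?_
  rw [← Finset.sum_mul, sum_antidiagonal_coeffQ hq, one_mul]

/-- The quadratic form of the identity minus a symmetric doubly stochastic matrix is a Dirichlet
form. -/
theorem sum_norm_sq_sub_sum_applyQ (φ : ℕ × ℕ → ℂ) (S : ℕ) :
    ∑ p ∈ Finset.HasAntidiagonal.antidiagonal S, ((‖φ p‖ ^ 2 : ℝ) : ℂ)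
        - ∑ p ∈ Finset.HasAntidiagonal.antidiagonal S, φ p * conj (applyQ φ p)
      = ((1 / 2 * ∑ p ∈ Finset.HasAntidiagonal.antidiagonal S,
          ∑ q ∈ Finset.HasAntidiagonal.antidiagonal S,
            coeffQ p.1 p.2 q.1 q.2 * ‖φ p - φ q‖ ^ 2 : ℝ) : ℂ) := by
  set A := Finset.HasAntidiagonal.antidiagonal S with hA
  have hn : ∀ z : ℂ, ((‖z‖ ^ 2 : ℝ) : ℂ) = z * conj z := fun z => by
    rw [Complex.mul_conj, Complex.normSq_eq_norm_sq]
  have h1 : ∑ p ∈ A, ∑ q ∈ A, (coeffQ p.1 p.2 q.1 q.2 : ℂ) * (φ p * conj (φ p))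
      = ∑ p ∈ A, φ p * conj (φ p) := by
    refine Finset.sum_congr rfl fun p hp => ?_
    rw [← Finset.sum_mul, ← Complex.ofReal_sum, sum_antidiagonal_coeffQ hp]
    simp
  have h2 : ∑ p ∈ A, ∑ q ∈ A, (coeffQ p.1 p.2 q.1 q.2 : ℂ) * (φ q * conj (φ q))
      = ∑ p ∈ A, φ p * conj (φ p) := by
    rw [← h1, Finset.sum_comm]
    refine Finset.sum_congr rfl fun p _ => Finset.sum_congr rfl fun q _ => ?_
    rw [coeffQ_comm]
  have h3 : ∑ p ∈ A, φ p * conj (applyQ φ p)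
      = ∑ p ∈ A, ∑ q ∈ A, (coeffQ p.1 p.2 q.1 q.2 : ℂ) * (φ p * conj (φ q)) := by
    refine Finset.sum_congr rfl fun p hp => ?_
    rw [applyQ_of_mem hp, map_sum, Finset.mul_sum]
    refine Finset.sum_congr rfl fun q _ => ?_
    rw [map_mul, Complex.conj_ofReal]
    ring
  have h4 : ∑ p ∈ A, φ p * conj (applyQ φ p)
      = ∑ p ∈ A, ∑ q ∈ A, (coeffQ p.1 p.2 q.1 q.2 : ℂ) * (φ q * conj (φ p)) := by
    rw [h3, Finset.sum_comm]
    refine Finset.sum_congr rfl fun p _ => Finset.sum_congr rfl fun q _ => ?_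
    rw [coeffQ_comm]
  have h5 : ∑ p ∈ A, ∑ q ∈ A, (coeffQ p.1 p.2 q.1 q.2 : ℂ) * ((‖φ p - φ q‖ ^ 2 : ℝ) : ℂ)
      = 2 * (∑ p ∈ A, φ p * conj (φ p) - ∑ p ∈ A, φ p * conj (applyQ φ p)) := by
    have : ∑ p ∈ A, ∑ q ∈ A, (coeffQ p.1 p.2 q.1 q.2 : ℂ) * ((‖φ p - φ q‖ ^ 2 : ℝ) : ℂ)
        = (∑ p ∈ A, ∑ q ∈ A, (coeffQ p.1 p.2 q.1 q.2 : ℂ) * (φ p * conj (φ p)))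
          + (∑ p ∈ A, ∑ q ∈ A, (coeffQ p.1 p.2 q.1 q.2 : ℂ) * (φ q * conj (φ q)))
          - (∑ p ∈ A, ∑ q ∈ A, (coeffQ p.1 p.2 q.1 q.2 : ℂ) * (φ p * conj (φ q)))
          - (∑ p ∈ A, ∑ q ∈ A, (coeffQ p.1 p.2 q.1 q.2 : ℂ) * (φ q * conj (φ p))) := by
      simp only [← Finset.sum_add_distrib, ← Finset.sum_sub_distrib]
      refine Finset.sum_congr rfl fun p _ => Finset.sum_congr rfl fun q _ => ?_
      rw [hn, map_sub]
      ring
    rw [this, h1, h2, ← h3, ← h4]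
    ring
  push_cast at h5 hn ⊢
  rw [h5]
  simp only [hn]
  ring

theorem hasSum_norm_sq (φ : PairSeq) : HasSum (fun p => ‖φ p‖ ^ 2) (‖φ‖ ^ 2) := by
  have := lp.hasSum_norm (p := 2) (by norm_num) φ
  simpa using this

theorem memℓp_applyQ (φ : PairSeq) : Memℓp (applyQ φ) 2 := by
  rw [memℓp_gen_iff (by norm_num)]
  simp only [ENNReal.toReal_ofNat, Real.rpow_ofNat]
  refine summable_of_summable_antidiagonal (fun _ => by positivity) ?_
  exact Summable.of_nonneg_of_le (fun S => Finset.sum_nonneg fun _ _ => by positivity)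
    (fun S => sum_norm_applyQ_sq_le φ S) (hasSum_antidiagonal (hasSum_norm_sq φ)).summable

/-- The operator with kernel `coeffQ` on each antidiagonal, as a linear map of `PairSeq`. -/
def pairOperatorLinear : PairSeq →ₗ[ℂ] PairSeq where
  toFun φ := ⟨applyQ φ, memℓp_applyQ φ⟩
  map_add' φ ψ := by
    ext p
    change applyQ (φ + ψ : PairSeq) p = applyQ φ p + applyQ ψ p
    simp [applyQ, add_mul, Finset.sum_add_distrib]
  map_smul' c φ := by
    ext p
    simp [applyQ, mul_assoc, Finset.mul_sum]

theorem norm_pairOperatorLinear_le (φ : PairSeq) : ‖pairOperatorLinear φ‖ ≤ 1 * ‖φ‖ := by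
  rw [one_mul]
  refine le_of_sq_le_sq ?_ (norm_nonneg _)
  exact hasSum_le (fun S => sum_norm_applyQ_sq_le φ S)
    (hasSum_antidiagonal (hasSum_norm_sq (pairOperatorLinear φ)))
    (hasSum_antidiagonal (hasSum_norm_sq φ))

/-- The operator with kernel `coeffQ` on each antidiagonal, as a bounded operator. -/
def pairOperator : PairSeq →L[ℂ] PairSeq :=
  pairOperatorLinear.mkContinuous 1 norm_pairOperatorLinear_le

theorem pairOperator_apply (φ : PairSeq) (p : ℕ × ℕ) : pairOperator φ p = applyQ φ p := rfl

theorem hasSum_inner_pairOperator (φ : PairSeq) :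
    HasSum (fun p => φ p * conj (applyQ φ p)) (inner ℂ (pairOperator φ) φ) :=
  lp.hasSum_inner (pairOperator φ) φ

theorem inner_pairOperator_eq_iff (φ : PairSeq) :
    inner ℂ (pairOperator φ) φ = (‖φ‖ : ℂ) ^ 2 ↔
      ∀ a b c d : ℕ, a + b = c + d → φ (a, b) = φ (c, d) := by
  have h1 := hasSum_antidiagonal (hasSum_inner_pairOperator φ)
  have h2 := hasSum_antidiagonal (Complex.hasSum_ofReal.mpr (hasSum_norm_sq φ))
  have h3 := h2.sub h1
  simp only [sum_norm_sq_sub_sum_applyQ] at h3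
  push_cast only [Complex.ofReal_pow] at h3
  constructor
  · intro h
    rw [h, sub_self, ← Complex.ofReal_zero, Complex.hasSum_ofReal] at h3
    rw [hasSum_zero_iff_of_nonneg] at h3
    · intro a b c d habcd
      have h4 := congrFun h3 (a + b)
      have h5 : ∀ p ∈ Finset.HasAntidiagonal.antidiagonal (a + b),
          0 ≤ ∑ q ∈ Finset.HasAntidiagonal.antidiagonal (a + b),
            coeffQ p.1 p.2 q.1 q.2 * ‖φ p - φ q‖ ^ 2 := fun p hp =>
        Finset.sum_nonneg fun q hq => mul_nonneg (coeffQ_pos_of_mem hp hq).le (sq_nonneg _)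
      have hab : (a, b) ∈ Finset.HasAntidiagonal.antidiagonal (a + b) := by simp
      have hcd : (c, d) ∈ Finset.HasAntidiagonal.antidiagonal (a + b) := by simp [habcd]
      have h6 := (Finset.sum_eq_zero_iff_of_nonneg h5).mp (by simpa using h4) _ hab
      rw [Finset.sum_eq_zero_iff_of_nonneg fun q hq =>
        mul_nonneg (coeffQ_pos_of_mem hab hq).le (sq_nonneg _)] at h6
      have h7 := h6 _ hcd
      have h8 := (mul_eq_zero.mp h7).resolve_left (coeffQ_pos_of_mem hab hcd).ne'
      rwa [sq_eq_zero_iff, norm_eq_zero, sub_eq_zero] at h8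
    · intro S
      exact mul_nonneg (by norm_num) (Finset.sum_nonneg fun p hp => Finset.sum_nonneg fun q hq =>
        mul_nonneg (coeffQ_pos_of_mem hp hq).le (sq_nonneg _))
  · intro h
    have h4 : ∀ S, 1 / 2 * ∑ p ∈ Finset.HasAntidiagonal.antidiagonal S,
          ∑ q ∈ Finset.HasAntidiagonal.antidiagonal S,
            coeffQ p.1 p.2 q.1 q.2 * ‖φ p - φ q‖ ^ 2 = 0 := by
      intro S
      rw [mul_eq_zero]
      right
      refine Finset.sum_eq_zero fun p hp => Finset.sum_eq_zero fun q hq => ?_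
      rw [Finset.HasAntidiagonal.mem_antidiagonal] at hp hq
      rw [h p.1 p.2 q.1 q.2 (hp.trans hq.symm)]
      simp
    simp only [h4, Complex.ofReal_zero] at h3
    exact (sub_eq_zero.mp (h3.unique hasSum_zero)).symm

theorem norm_pairOperator : ‖pairOperator‖ = 1 := by
  refine le_antisymm (LinearMap.mkContinuous_norm_le _ zero_le_one _) ?_
  -- the antidiagonal of `(0, 0)` is a single point, so this family is fixed by the operator
  set φ : PairSeq := lp.single 2 (0, 0) (1 : ℂ) with hφ
  have hn : ‖φ‖ = 1 := by rw [hφ, lp.norm_single (by norm_num)]; simp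
  have h : inner ℂ (pairOperator φ) φ = (‖φ‖ : ℂ) ^ 2 := by
    rw [inner_pairOperator_eq_iff]
    intro a b c d h
    simp only [hφ, lp.single_apply, Pi.single_apply, Prod.mk.injEq]
    congr 1
    exact propext ⟨fun h' => by omega, fun h' => by omega⟩
  have h2 := norm_inner_le_norm (𝕜 := ℂ) (pairOperator φ) φ
  rw [h, hn] at h2
  simpa [hn] using h2.trans (by simpa [hn] using pairOperator.le_opNorm φ)

/-! ### The generating function -/

/-- The generating function of the Laguerre polynomials, by interchanging the summations over the
degree and over the power of `x`. -/
theorem hasSum_pow_mul_laguerre {r : ℂ} (hr : ‖r‖ < 1) (x : ℝ) :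
    HasSum (fun n => r ^ n * (laguerre n x : ℂ))
      ((1 - r)⁻¹ * Complex.exp (-(r * x / (1 - r)))) := by
  have h1r : (1 - r) ≠ 0 := fun h => by
    rw [sub_eq_zero] at h
    simp [← h] at hr
  -- the terms of the double series, indexed by the power `p.1` of `x` and the excess `p.2` of the
  -- degree over it
  set f : ℕ × ℕ → ℂ := fun p =>
    (-(x : ℂ)) ^ p.1 / p.1.factorial * r ^ p.1 * ((p.2 + p.1).choose p.1 * r ^ p.2) with hf
  have hinner : ∀ k, HasSum (fun n => f (k, n))
      ((1 - r)⁻¹ * ((-(r * x / (1 - r))) ^ k / k.factorial)) := by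
    intro k
    have := (hasSum_choose_mul_geometric_of_norm_lt_one k hr).mul_left
      ((-(x : ℂ)) ^ k / k.factorial * r ^ k)
    convert! this using 1
    rw [show -(r * x / (1 - r)) = (-x) * r / (1 - r) by ring, div_pow, mul_pow]
    field_simp
    ring
  have hinner' : ∀ k, HasSum (fun n => ‖f (k, n)‖)
      ((1 - ‖r‖)⁻¹ * ((|x| * ‖r‖ / (1 - ‖r‖)) ^ k / k.factorial)) := by
    intro k
    have := (hasSum_choose_mul_geometric_of_norm_lt_one (𝕜 := ℝ) k
      (r := ‖r‖) (by rwa [norm_norm])).mul_left (|x| ^ k / k.factorial * ‖r‖ ^ k)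
    convert! this using 1
    · ext n
      simp [hf]
    · have : (1 - ‖r‖) ≠ 0 := by linarith
      rw [div_pow, mul_pow]
      field_simp
      ring
  have hsum : Summable f := by
    refine Summable.of_norm ?_
    rw [summable_prod_of_nonneg fun _ => norm_nonneg _]
    refine ⟨fun k => (hinner' k).summable, ?_⟩
    refine Summable.congr ?_ fun k => ((hinner' k).tsum_eq).symm
    exact (Real.summable_pow_div_factorial _).mul_left _
  have h2 : HasSum f ((1 - r)⁻¹ * Complex.exp (-(r * x / (1 - r)))) := by
    have h3 := hsum.hasSum.prod_fiberwise hinner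
    have h4 := (NormedSpace.expSeries_div_hasSum_exp (𝔸 := ℂ) (-(r * x / (1 - r)))).mul_left
      (1 - r)⁻¹
    rw [← Complex.exp_eq_exp_ℂ] at h4
    rw [← h3.unique h4]
    exact hsum.hasSum
  refine (hasSum_antidiagonal h2).congr_fun fun n => ?_
  rw [Finset.Nat.sum_antidiagonal_eq_sum_range_succ_mk, laguerre]
  push_cast
  rw [Finset.mul_sum]
  refine Finset.sum_congr rfl fun k hk => ?_
  have hk' : k ≤ n := Nat.lt_succ_iff.mp (Finset.mem_range.mp hk)
  simp only [hf, Nat.sub_add_cancel hk']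
  rw [neg_pow, show r ^ n = r ^ k * r ^ (n - k) by rw [← pow_add, Nat.add_sub_cancel' hk']]
  ring

/-! ### Radial integrals over the plane -/

theorem integral_radial {E : Type*} [NormedAddCommGroup E] [NormedSpace ℝ E] (F : ℝ → E) {c : ℝ}
    (hc : 0 < c) :
    ∫ x : Plane, F (c * ‖x‖ ^ 2) = (Real.pi / c) • ∫ y in Set.Ioi (0 : ℝ), F y := by
  rw [integral_fun_norm_addHaar volume (fun y => F (c * y ^ 2))]
  have h1 : (volume : Measure Plane).real (Metric.ball 0 1) = Real.pi := by
    simp [Measure.real, EuclideanSpace.volume_ball_fin_two, Real.pi_nonneg]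
  have h2 := integral_comp_rpow_Ioi_of_pos (g := fun y => F (c * y)) (p := 2) two_pos
  have h3 := integral_comp_mul_left_Ioi F 0 hc
  rw [mul_zero] at h3
  rw [h1, finrank_euclideanSpace_fin, div_eq_mul_inv, mul_smul, ← h3, ← h2,
    ← Nat.cast_smul_eq_nsmul ℝ, smul_comm, ← integral_smul]
  congr 1
  refine setIntegral_congr_fun measurableSet_Ioi fun y _ => ?_
  simp only [smul_smul]
  norm_num

theorem integrable_radial {E : Type*} [NormedAddCommGroup E] [NormedSpace ℝ E] {F : ℝ → E} {c : ℝ}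
    (hc : 0 < c) (hF : IntegrableOn F (Set.Ioi 0)) :
    Integrable fun x : Plane => F (c * ‖x‖ ^ 2) := by
  rw [integrable_fun_norm_addHaar volume (f := fun y => F (c * y ^ 2))]
  have h1 : IntegrableOn (fun y => F (c * y)) (Set.Ioi 0) := by
    rw [integrableOn_Ioi_comp_mul_left_iff F 0 hc, mul_zero]
    exact hF
  have h2 := (integrableOn_Ioi_comp_rpow_iff' (fun y => F (c * y)) (p := 2) two_ne_zero).mpr h1
  refine h2.congr_fun (fun y _ => ?_) measurableSet_Ioi
  norm_num

/-! ### The modes and their evolution -/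

theorem one_add_mul_I_ne_zero (s : ℝ) : (1 + s * Complex.I : ℂ) ≠ 0 := fun h => by
  simpa using congrArg Complex.re h

theorem one_sub_mul_I_ne_zero (s : ℝ) : (1 - s * Complex.I : ℂ) ≠ 0 := fun h => by
  simpa using congrArg Complex.re h

theorem one_add_mul_I_mul_one_sub_mul_I (s : ℝ) :
    (1 + s * Complex.I : ℂ) * (1 - s * Complex.I) = ((1 + s ^ 2 : ℝ) : ℂ) := by
  push_cast
  linear_combination -(s : ℂ) ^ 2 * Complex.I_sq

theorem conj_one_add_mul_I (s : ℝ) :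
    conj (1 + s * Complex.I : ℂ) = 1 - s * Complex.I := by
  simp [sub_eq_add_neg]

/-- The unimodular factor by which the evolution multiplies consecutive modes. -/
def phase (s : ℝ) : ℂ := (1 - s * Complex.I) / (1 + s * Complex.I)

theorem phase_ne_zero (s : ℝ) : phase s ≠ 0 :=
  div_ne_zero (one_sub_mul_I_ne_zero s) (one_add_mul_I_ne_zero s)

theorem conj_phase (s : ℝ) : conj (phase s) = (phase s)⁻¹ := by
  rw [phase, map_div₀, conj_one_add_mul_I, ← conj_one_add_mul_I, Complex.conj_conj, inv_div]

theorem norm_phase (s : ℝ) : ‖phase s‖ = 1 := by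
  rw [phase, norm_div, ← conj_one_add_mul_I, Complex.norm_conj,
    div_self (norm_ne_zero_iff.mpr (one_add_mul_I_ne_zero s))]

/-- The mode `laguerreFun n` evolved to the time `s / (4 * π)`. -/
def evolvedMode (s : ℝ) (n : ℕ) (x : Plane) : ℂ :=
  (1 + s * Complex.I)⁻¹ * phase s ^ n * (laguerre n (2 * Real.pi / (1 + s ^ 2) * ‖x‖ ^ 2) : ℂ)
    * Complex.exp (-Real.pi * ‖x‖ ^ 2 / (1 + s * Complex.I))

theorem evolvedMode_zero (n : ℕ) (x : Plane) : evolvedMode 0 n x = (laguerreFun n x : ℂ) := by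
  simp [evolvedMode, laguerreFun, phase]

theorem continuous_laguerre (n : ℕ) : Continuous (laguerre n) := by
  unfold laguerre
  fun_prop

theorem continuous_evolvedMode (n : ℕ) :
    Continuous fun p : ℝ × Plane => evolvedMode p.1 n p.2 := by
  have h1 : ∀ p : ℝ × Plane, (1 + p.1 * Complex.I : ℂ) ≠ 0 := fun p => one_add_mul_I_ne_zero p.1
  have h2 : ∀ p : ℝ × Plane, (1 + p.1 ^ 2) ≠ 0 := fun p => by positivity
  have h3 := continuous_laguerre n
  unfold evolvedMode phase
  fun_prop (disch := assumption)

theorem evolvedMode_mul_conj (s : ℝ) (a c : ℕ) (x : Plane) :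
    evolvedMode s a x * conj (evolvedMode s c x)
      = ((1 + s ^ 2)⁻¹ : ℝ) * phase s ^ ((a : ℤ) - c) *
        ((laguerre a (2 * Real.pi / (1 + s ^ 2) * ‖x‖ ^ 2)
          * laguerre c (2 * Real.pi / (1 + s ^ 2) * ‖x‖ ^ 2)
          * Real.exp (-(2 * Real.pi / (1 + s ^ 2) * ‖x‖ ^ 2)) : ℝ) : ℂ) := by
  have h1 := one_add_mul_I_ne_zero s
  have h2 := one_sub_mul_I_ne_zero s
  have h3 : (((1 + s ^ 2 : ℝ) : ℂ)) ≠ 0 := by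
    rw [← one_add_mul_I_mul_one_sub_mul_I]
    exact mul_ne_zero h1 h2
  have he : Complex.exp (-Real.pi * ‖x‖ ^ 2 / (1 + s * Complex.I)) *
      Complex.exp (-Real.pi * ‖x‖ ^ 2 / (1 - s * Complex.I))
      = Complex.exp (-(2 * Real.pi / ((1 + s ^ 2 : ℝ) : ℂ) * ‖x‖ ^ 2)) := by
    rw [← Complex.exp_add, ← one_add_mul_I_mul_one_sub_mul_I]
    congr 1
    field_simp
    ring
  have hi : (1 + s * Complex.I : ℂ)⁻¹ * (1 - s * Complex.I)⁻¹ = ((1 + s ^ 2 : ℝ) : ℂ)⁻¹ := by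
    rw [← mul_inv, one_add_mul_I_mul_one_sub_mul_I]
  have hp : phase s ^ ((a : ℤ) - c) = phase s ^ a * (phase s)⁻¹ ^ c := by
    rw [zpow_sub₀ (phase_ne_zero s), zpow_natCast, zpow_natCast, inv_pow, div_eq_mul_inv]
  have hc : conj (evolvedMode s c x) = (1 - s * Complex.I)⁻¹ * (phase s)⁻¹ ^ c *
      (laguerre c (2 * Real.pi / (1 + s ^ 2) * ‖x‖ ^ 2) : ℂ)
      * Complex.exp (-Real.pi * ‖x‖ ^ 2 / (1 - s * Complex.I)) := by
    rw [evolvedMode]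
    simp only [map_mul, map_inv₀, map_pow, conj_phase, Complex.conj_ofReal, ← Complex.exp_conj,
      map_div₀, map_neg, conj_one_add_mul_I]
  rw [hc, evolvedMode, hp]
  push_cast at he hi ⊢
  rw [← he, ← hi]
  ring

theorem norm_evolvedMode_sq (s : ℝ) (n : ℕ) (x : Plane) :
    ‖evolvedMode s n x‖ ^ 2 = (1 + s ^ 2)⁻¹ *
      (laguerre n (2 * Real.pi / (1 + s ^ 2) * ‖x‖ ^ 2)
          * laguerre n (2 * Real.pi / (1 + s ^ 2) * ‖x‖ ^ 2)
          * Real.exp (-(2 * Real.pi / (1 + s ^ 2) * ‖x‖ ^ 2))) := by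
  have := evolvedMode_mul_conj s n n x
  rw [Complex.mul_conj, Complex.normSq_eq_norm_sq, sub_self, zpow_zero, mul_one] at this
  exact_mod_cast this

theorem memLp_evolvedMode (s : ℝ) (n : ℕ) : MemLp (evolvedMode s n) 2 volume := by
  have hm : AEStronglyMeasurable (evolvedMode s n) volume :=
    ((continuous_evolvedMode n).comp (by fun_prop : Continuous fun x : Plane => (s, x))
      ).aestronglyMeasurable
  rw [memLp_two_iff_integrable_sq_norm hm]
  simp only [norm_evolvedMode_sq]
  exact (integrable_radial (by positivity) (integrableOn_laguerre_mul_laguerre n n)).const_mul _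

/-- The evolved mode as an element of `L²`. -/
def modeLp (s : ℝ) (n : ℕ) : L2Plane := (memLp_evolvedMode s n).toLp _

theorem coeFn_modeLp (s : ℝ) (n : ℕ) : modeLp s n =ᵐ[volume] evolvedMode s n :=
  MemLp.coeFn_toLp _

theorem inner_modeLp (s : ℝ) (m n : ℕ) :
    inner ℂ (modeLp s m) (modeLp s n) = if m = n then (1 / 2 : ℂ) else 0 := by
  have h1 : ∀ᵐ x, inner ℂ (modeLp s m x) (modeLp s n x)
      = evolvedMode s n x * conj (evolvedMode s m x) := by
    filter_upwards [coeFn_modeLp s m, coeFn_modeLp s n] with x hm hn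
    rw [hm, hn, RCLike.inner_apply]
  rw [L2.inner_def, integral_congr_ae h1]
  simp only [evolvedMode_mul_conj]
  rw [integral_const_mul, integral_complex_ofReal]
  have h2 := integral_radial (fun y => laguerre n y * laguerre m y * Real.exp (-y))
    (c := 2 * Real.pi / (1 + s ^ 2)) (by positivity)
  have h3 := integral_laguerre_mul_laguerre n m
  have hs : (1 + s ^ 2 : ℝ) ≠ 0 := by positivity
  have hs' : (1 + s ^ 2 : ℂ) ≠ 0 := by exact_mod_cast hs
  rw [h3] at h2
  rw [h2]
  by_cases h : m = n
  · subst h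
    have := Real.pi_ne_zero
    simp
    field_simp
  · simp [h, Ne.symm h]

theorem norm_modeLp_sq (s : ℝ) (n : ℕ) : ‖modeLp s n‖ ^ 2 = 1 / 2 := by
  have := inner_self_eq_norm_sq_to_K (𝕜 := ℂ) (modeLp s n)
  rw [inner_modeLp, if_pos rfl] at this
  have h2 : ((1 / 2 : ℝ) : ℂ) = ((‖modeLp s n‖ ^ 2 : ℝ) : ℂ) := by
    push_cast
    exact this
  exact_mod_cast h2.symm

theorem norm_modeLp_le (s : ℝ) (n : ℕ) : ‖modeLp s n‖ ≤ 1 := by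
  have := norm_modeLp_sq s n
  nlinarith [norm_nonneg (modeLp s n)]

/-- The limit in `L^p` of a sequence that converges almost everywhere is its pointwise limit. -/
theorem ae_eq_of_tendsto_of_ae_tendsto {α E : Type*} [MeasurableSpace α] {μ : Measure α}
    [NormedAddCommGroup E] {p : ENNReal} [Fact (1 ≤ p)] {F : ℕ → Lp E p μ} {g : Lp E p μ}
    {G : α → E} (h : Tendsto F atTop (𝓝 g))
    (hG : ∀ᵐ x ∂μ, Tendsto (fun n => F n x) atTop (𝓝 (G x))) : g =ᵐ[μ] G := by
  obtain ⟨ns, hns, h2⟩ := (tendstoInMeasure_of_tendsto_Lp h).exists_seq_tendsto_ae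
  filter_upwards [hG, h2] with x h3 h4
  exact tendsto_nhds_unique h4 (h3.comp hns.tendsto_atTop)

/-- The Gaussian with generating parameter `r`, evolved to the time `s / (4 * π)`. -/
def evolvedGaussian (s r : ℝ) (x : Plane) : ℂ :=
  ((1 + s * Complex.I) - r * (1 - s * Complex.I))⁻¹ *
    Complex.exp (-Real.pi * (1 + r) / ((1 + s * Complex.I) - r * (1 - s * Complex.I)) * ‖x‖ ^ 2)

theorem evolvedGaussian_denom_ne_zero (s : ℝ) {r : ℝ} (hr : |r| < 1) :
    ((1 + s * Complex.I) - r * (1 - s * Complex.I) : ℂ) ≠ 0 := fun h => by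
  have := congrArg Complex.re h
  simp at this
  rw [abs_lt] at hr
  linarith

/-- The generating function of the evolved modes is a Gaussian at every time. -/
theorem hasSum_evolvedMode (s : ℝ) {r : ℝ} (hr : |r| < 1) (x : Plane) :
    HasSum (fun n => (r : ℂ) ^ n * evolvedMode s n x) (evolvedGaussian s r x) := by
  have h0 : ‖(r : ℂ) * phase s‖ < 1 := by
    rw [norm_mul, norm_phase, mul_one, Complex.norm_real]
    exact hr
  have h1 := one_add_mul_I_ne_zero s
  have h2 := one_sub_mul_I_ne_zero s
  have h3 := evolvedGaussian_denom_ne_zero s hr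
  have h4 : (1 - r * phase s : ℂ)
      = ((1 + s * Complex.I) - r * (1 - s * Complex.I)) / (1 + s * Complex.I) := by
    rw [phase]
    field_simp
  have h := (hasSum_pow_mul_laguerre h0 (2 * Real.pi / (1 + s ^ 2) * ‖x‖ ^ 2)).mul_left
    ((1 + s * Complex.I)⁻¹ * Complex.exp (-Real.pi * ‖x‖ ^ 2 / (1 + s * Complex.I)))
  convert! h using 1
  · ext n
    rw [evolvedMode, mul_pow]
    ring
  · rw [evolvedGaussian, h4, inv_div, mul_mul_mul_comm, ← Complex.exp_add, phase]
    congr 1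
    · field_simp
    · congr 1
      have h5 := one_add_mul_I_mul_one_sub_mul_I s
      push_cast at h5 ⊢
      rw [← h5]
      field_simp
      ring

theorem summable_smul_modeLp (s : ℝ) {r : ℝ} (hr : |r| < 1) :
    Summable fun n => (r : ℂ) ^ n • modeLp s n := by
  refine Summable.of_norm_bounded (summable_geometric_of_lt_one (abs_nonneg r) hr) fun n => ?_
  rw [norm_smul, norm_pow, Complex.norm_real, Real.norm_eq_abs]
  exact mul_le_of_le_one_right (by positivity) (norm_modeLp_le s n)

theorem coeFn_sum_smul_modeLp (s : ℝ) (α : ℕ → ℂ) (A : Finset ℕ) :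
    (∑ n ∈ A, α n • modeLp s n : L2Plane)
      =ᵐ[volume] fun x => ∑ n ∈ A, α n * evolvedMode s n x := by
  have h1 := Lp.coeFn_finsetSum A fun n => α n • modeLp s n
  have h2 : ∀ᵐ x, ∀ n, (α n • modeLp s n : L2Plane) x = α n * evolvedMode s n x := by
    rw [ae_all_iff]
    intro n
    filter_upwards [Lp.coeFn_smul (α n) (modeLp s n), coeFn_modeLp s n] with x h3 h4
    rw [h3, Pi.smul_apply, h4, smul_eq_mul]
  filter_upwards [h1, h2] with x h3 h4
  rw [h3]
  simp [h4]

theorem coeFn_tsum_modeLp (s : ℝ) {r : ℝ} (hr : |r| < 1) :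
    (∑' n, (r : ℂ) ^ n • modeLp s n : L2Plane) =ᵐ[volume] evolvedGaussian s r := by
  refine ae_eq_of_tendsto_of_ae_tendsto (summable_smul_modeLp s hr).hasSum.tendsto_sum_nat ?_
  have h2 : ∀ᵐ x, ∀ N, (∑ n ∈ Finset.range N, (r : ℂ) ^ n • modeLp s n : L2Plane) x
      = ∑ n ∈ Finset.range N, (r : ℂ) ^ n * evolvedMode s n x := by
    rw [ae_all_iff]
    exact fun N => coeFn_sum_smul_modeLp s (fun n => (r : ℂ) ^ n) _
  filter_upwards [h2] with x h3
  simp only [h3]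
  exact (hasSum_evolvedMode s hr x).tendsto_sum_nat

/-! ### The Schrödinger flow on Gaussians and on modes -/

/-- The `L²` Fourier transform of an integrable function is given by the Fourier integral. -/
theorem fourier_toLp_eq {f : Plane → ℂ} (hf : Integrable f) (hf2 : MemLp f 2 volume)
    (hF2 : MemLp (𝓕 f) 2 volume) : 𝓕 (hf2.toLp f) = hF2.toLp (𝓕 f) := by
  apply LinearMap.ker_eq_bot.mp
    (Lp.ker_toTemperedDistributionCLM_eq_bot (F := ℂ) (μ := (volume : Measure Plane)) (p := 2))
  ext g
  change Lp.toTemperedDistribution (𝓕 (hf2.toLp f)) g = Lp.toTemperedDistribution (hF2.toLp (𝓕 f)) g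
  rw [← Lp.fourier_toTemperedDistribution_eq, TemperedDistribution.fourier_apply,
    Lp.toTemperedDistribution_apply, Lp.toTemperedDistribution_apply]
  have h1 : ∫ x, (𝓕 g) x • (hf2.toLp f) x = ∫ x, (𝓕 (g : Plane → ℂ)) x • f x := by
    refine integral_congr_ae ?_
    filter_upwards [hf2.coeFn_toLp] with x hx
    rw [hx, SchwartzMap.fourier_coe]
  have h2 : ∫ x, g x • (hF2.toLp (𝓕 f)) x = ∫ x, g x • (𝓕 f) x := by
    refine integral_congr_ae ?_
    filter_upwards [hF2.coeFn_toLp] with x hx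
    rw [hx]
  rw [h1, h2]
  simpa using! VectorFourier.integral_fourierIntegral_smul_eq_flip (L := innerₗ Plane)
      (μ := volume) (ν := volume)
      Real.continuous_fourierChar continuous_inner g.integrable hf

theorem integrable_gaussian {b : ℂ} (hb : 0 < b.re) :
    Integrable fun x : Plane => Complex.exp (-b * ‖x‖ ^ 2) := by
  simpa using GaussianFourier.integrable_cexp_neg_mul_sq_norm_add hb 0 (0 : Plane)

theorem memLp_gaussian {b : ℂ} (hb : 0 < b.re) :
    MemLp (fun x : Plane => Complex.exp (-b * ‖x‖ ^ 2)) 2 volume := by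
  rw [memLp_two_iff_integrable_sq_norm (integrable_gaussian hb).1]
  refine (integrable_gaussian (b := 2 * b) (by simpa using hb)).norm.congr
    (Eventually.of_forall fun x => ?_)
  beta_reduce
  rw [← norm_pow, ← Complex.exp_nat_mul]
  congr 2
  push_cast
  ring

/-- The Gaussian `exp (-b ‖x‖²)` as an element of `L²`. -/
def gaussianLp {b : ℂ} (hb : 0 < b.re) : L2Plane := (memLp_gaussian hb).toLp _

theorem coeFn_gaussianLp {b : ℂ} (hb : 0 < b.re) :
    gaussianLp hb =ᵐ[volume] fun x => Complex.exp (-b * ‖x‖ ^ 2) :=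
  MemLp.coeFn_toLp _

theorem coeFn_fourier_gaussianLp {b : ℂ} (hb : 0 < b.re) :
    (𝓕 (gaussianLp hb) : L2Plane) =ᵐ[volume]
      fun w => Real.pi / b * Complex.exp (-Real.pi ^ 2 * ‖w‖ ^ 2 / b) := by
  have h1 : 𝓕 (fun x : Plane => Complex.exp (-b * ‖x‖ ^ 2))
      = fun w => Real.pi / b * Complex.exp (-Real.pi ^ 2 * ‖w‖ ^ 2 / b) := by
    ext w
    rw [fourier_gaussian_innerProductSpace hb]
    simp
  have hb' : 0 < ((Real.pi : ℂ) ^ 2 / b).re := by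
    rw [← Complex.ofReal_pow, Complex.div_re, Complex.ofReal_re, Complex.ofReal_im]
    have : 0 < Complex.normSq b := Complex.normSq_pos.mpr fun h => by simp [h] at hb
    have := Real.pi_pos
    simp only [zero_mul, zero_div, add_zero]
    positivity
  have h2 : MemLp (𝓕 (fun x : Plane => Complex.exp (-b * ‖x‖ ^ 2))) 2 volume := by
    rw [h1]
    refine ((memLp_gaussian hb').const_mul (Real.pi / b : ℂ)).congr_norm ?_ ?_
    · fun_prop
    · refine Eventually.of_forall fun w => ?_
      congr 3
      ring
  rw [gaussianLp, fourier_toLp_eq (integrable_gaussian hb) _ h2]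
  filter_upwards [h2.coeFn_toLp] with w hw
  rw [hw, h1]

theorem fourier_schrodingerFlow (t : ℝ) (f : L2Plane) :
    𝓕 (schrodingerFlow t f) = (memLp_flowMultiplier_mul t (𝓕 f)).toLp _ :=
  fourier_fourierInv_eq _

theorem coeFn_fourier_schrodingerFlow (t : ℝ) (f : L2Plane) :
    (𝓕 (schrodingerFlow t f) : L2Plane) =ᵐ[volume]
      fun y => flowMultiplier t y * (𝓕 f : L2Plane) y := by
  rw [fourier_schrodingerFlow]
  exact MemLp.coeFn_toLp _

theorem fourier_injective : Function.Injective (𝓕 : L2Plane → L2Plane) :=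
  (Lp.fourierTransformₗᵢ Plane ℂ).injective

/-- The free Schrödinger flow as a linear isometry. -/
def flowIsometry (t : ℝ) : L2Plane →ₗᵢ[ℂ] L2Plane where
  toFun := schrodingerFlow t
  map_add' f g := by
    apply fourier_injective
    rw [FourierAdd.fourier_add]
    refine Lp.ext ?_
    have h := coeFn_fourier_schrodingerFlow t (f + g)
    rw [FourierAdd.fourier_add] at h
    filter_upwards [h, coeFn_fourier_schrodingerFlow t f,
      coeFn_fourier_schrodingerFlow t g, Lp.coeFn_add (𝓕 f : L2Plane) (𝓕 g),
      Lp.coeFn_add (𝓕 (schrodingerFlow t f) : L2Plane) (𝓕 (schrodingerFlow t g))]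
      with y h1 h2 h3 h4 h5
    rw [h1, h4, h5, Pi.add_apply, Pi.add_apply, h2, h3, mul_add]
  map_smul' c f := by
    apply fourier_injective
    rw [RingHom.id_apply, FourierSMul.fourier_smul]
    refine Lp.ext ?_
    have h := coeFn_fourier_schrodingerFlow t (c • f)
    rw [FourierSMul.fourier_smul] at h
    filter_upwards [h, coeFn_fourier_schrodingerFlow t f, Lp.coeFn_smul c (𝓕 f : L2Plane),
      Lp.coeFn_smul c (𝓕 (schrodingerFlow t f) : L2Plane)] with y h1 h2 h3 h4
    rw [h1, h3, h4, Pi.smul_apply, Pi.smul_apply, h2, smul_eq_mul, smul_eq_mul, mul_left_comm]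
  norm_map' f := by
    change ‖schrodingerFlow t f‖ = ‖f‖
    rw [← Lp.norm_fourier_eq (schrodingerFlow t f), ← Lp.norm_fourier_eq f]
    have h : ∀ᵐ y, ‖(𝓕 (schrodingerFlow t f) : L2Plane) y‖ = ‖(𝓕 f : L2Plane) y‖ := by
      filter_upwards [coeFn_fourier_schrodingerFlow t f] with y hy
      rw [hy, norm_mul, norm_flowMultiplier, one_mul]
    exact le_antisymm (Lp.norm_le_norm_of_ae_le (h.mono fun y hy => hy.le))
      (Lp.norm_le_norm_of_ae_le (h.mono fun y hy => hy.ge))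

theorem flowIsometry_apply (t : ℝ) (f : L2Plane) : flowIsometry t f = schrodingerFlow t f := rfl

theorem evolvedGaussian_exponent_re_pos (s : ℝ) {r : ℝ} (hr : |r| < 1) :
    0 < (Real.pi * (1 + r) / ((1 + s * Complex.I) - r * (1 - s * Complex.I)) : ℂ).re := by
  rw [abs_lt] at hr
  have h0 := evolvedGaussian_denom_ne_zero s (abs_lt.mpr hr)
  have h1 : 0 < Complex.normSq ((1 + s * Complex.I) - r * (1 - s * Complex.I)) :=
    Complex.normSq_pos.mpr h0
  have h2 : ((Real.pi : ℂ) * (1 + r)) = ((Real.pi * (1 + r) : ℝ) : ℂ) := by push_cast; ring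
  rw [h2, Complex.div_re, Complex.ofReal_re, Complex.ofReal_im, zero_mul, zero_div, add_zero]
  have h3 : ((1 + s * Complex.I) - r * (1 - s * Complex.I) : ℂ).re = 1 - r := by simp
  rw [h3]
  have h4 : 0 < 1 - r := by linarith
  have h5 : 0 < 1 + r := by linarith
  have := Real.pi_pos
  positivity

theorem tsum_modeLp_eq_gaussianLp (s : ℝ) {r : ℝ} (hr : |r| < 1) :
    (∑' n, (r : ℂ) ^ n • modeLp s n : L2Plane)
      = ((1 + s * Complex.I) - r * (1 - s * Complex.I) : ℂ)⁻¹ •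
        gaussianLp (evolvedGaussian_exponent_re_pos s hr) := by
  refine Lp.ext ?_
  filter_upwards [coeFn_tsum_modeLp s hr, Lp.coeFn_smul
    ((1 + s * Complex.I) - r * (1 - s * Complex.I) : ℂ)⁻¹
    (gaussianLp (evolvedGaussian_exponent_re_pos s hr)),
    coeFn_gaussianLp (evolvedGaussian_exponent_re_pos s hr)] with x h1 h2 h3
  rw [h1, h2, Pi.smul_apply, h3, evolvedGaussian, smul_eq_mul]
  congr 3
  ring

/-- The flow maps the generating function of the modes to the generating function of the evolved
modes: both are Gaussians. -/
theorem flowIsometry_tsum_modeLp (t : ℝ) {r : ℝ} (hr : |r| < 1) :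
    flowIsometry t (∑' n, (r : ℂ) ^ n • modeLp 0 n)
      = ∑' n, (r : ℂ) ^ n • modeLp (4 * Real.pi * t) n := by
  rw [tsum_modeLp_eq_gaussianLp 0 hr, tsum_modeLp_eq_gaussianLp (4 * Real.pi * t) hr, map_smul,
    flowIsometry_apply]
  apply fourier_injective
  rw [FourierSMul.fourier_smul, FourierSMul.fourier_smul]
  refine Lp.ext ?_
  have h1r : (1 - r : ℂ) ≠ 0 := by
    have := evolvedGaussian_denom_ne_zero 0 hr
    simpa using this
  have h2r : (1 + r : ℂ) ≠ 0 := by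
    rw [abs_lt] at hr
    exact_mod_cast (by linarith : (1 + r) ≠ 0)
  have hD := evolvedGaussian_denom_ne_zero (4 * Real.pi * t) hr
  have hpi : (Real.pi : ℂ) ≠ 0 := by exact_mod_cast Real.pi_ne_zero
  filter_upwards [Lp.coeFn_smul ((1 + (0 : ℝ) * Complex.I) - r * (1 - (0 : ℝ) * Complex.I) : ℂ)⁻¹
    (𝓕 (schrodingerFlow t (gaussianLp (evolvedGaussian_exponent_re_pos 0 hr))) : L2Plane),
    Lp.coeFn_smul ((1 + (4 * Real.pi * t : ℝ) * Complex.I)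
      - r * (1 - (4 * Real.pi * t : ℝ) * Complex.I) : ℂ)⁻¹
    (𝓕 (gaussianLp (evolvedGaussian_exponent_re_pos (4 * Real.pi * t) hr)) : L2Plane),
    coeFn_fourier_schrodingerFlow t (gaussianLp (evolvedGaussian_exponent_re_pos 0 hr)),
    coeFn_fourier_gaussianLp (evolvedGaussian_exponent_re_pos 0 hr),
    coeFn_fourier_gaussianLp (evolvedGaussian_exponent_re_pos (4 * Real.pi * t) hr)]
    with y h1 h2 h3 h4 h5
  rw [h1, h2, Pi.smul_apply, Pi.smul_apply, h3, h4, h5, flowMultiplier, smul_eq_mul, smul_eq_mul,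
    ← mul_assoc (Complex.exp _), mul_comm (Complex.exp _), mul_assoc, ← Complex.exp_add,
    ← mul_assoc, ← mul_assoc]
  congr 1
  · simp only [Complex.ofReal_zero, zero_mul, add_zero, sub_zero, mul_one]
    field_simp
  · congr 1
    simp only [Complex.ofReal_zero, zero_mul, add_zero, sub_zero, mul_one]
    push_cast at hD ⊢
    field_simp
    ring

/-- The coefficients of a vector valued power series are determined by its values at real
points. -/
theorem eq_zero_of_hasSum_pow_smul {E : Type*} [NormedAddCommGroup E] [NormedSpace ℂ E]
    {a : ℕ → E} (h : ∀ r : ℝ, |r| < 1 → HasSum (fun n => (r : ℂ) ^ n • a n) 0) (n : ℕ) :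
    a n = 0 := by
  let : NormedSpace ℝ E := NormedSpace.complexToReal
  set p : FormalMultilinearSeries ℝ ℝ E :=
    fun n => ContinuousMultilinearMap.mkPiRing ℝ (Fin n) (a n) with hp
  have hc : ∀ n, p.coeff n = a n := fun n => by simp [hp, FormalMultilinearSeries.coeff]
  have h1 : HasFPowerSeriesAt (0 : ℝ → E) p 0 := by
    rw [hasFPowerSeriesAt_iff]
    filter_upwards [Metric.ball_mem_nhds (0 : ℝ) one_pos] with r hr
    rw [mem_ball_zero_iff, Real.norm_eq_abs] at hr
    refine (h r hr).congr_fun fun n => ?_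
    rw [hc, ← Complex.ofReal_pow, Complex.coe_smul]
  rw [← hc, h1.eq_zero]
  rfl

/-- The flow evolves `laguerreFun n` into `evolvedMode`. -/
theorem flowIsometry_modeLp (t : ℝ) (n : ℕ) :
    flowIsometry t (modeLp 0 n) = modeLp (4 * Real.pi * t) n := by
  rw [← sub_eq_zero]
  refine eq_zero_of_hasSum_pow_smul (a := fun n => flowIsometry t (modeLp 0 n)
    - modeLp (4 * Real.pi * t) n) (fun r hr => ?_) n
  have h1 := (flowIsometry t).toContinuousLinearMap.hasSum (summable_smul_modeLp 0 hr).hasSum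
  have h2 := (summable_smul_modeLp (4 * Real.pi * t) hr).hasSum
  have h3 := h1.sub h2
  simp only [LinearIsometry.coe_toContinuousLinearMap, flowIsometry_tsum_modeLp t hr,
    sub_self, map_smul, ← smul_sub] at h3
  exact h3

/-! ### Completeness of the modes among radial functions -/

/-- The Gaussian `exp (-π ‖x‖²)` as a real function; it is an injective function of `‖x‖`. -/
def gaussianProfile (x : Plane) : ℝ := Real.exp (-Real.pi * ‖x‖ ^ 2)

theorem measurable_gaussianProfile : Measurable gaussianProfile := by
  unfold gaussianProfile
  fun_prop

/-- The distribution of the Gaussian profile, a measure on `(0, 1]`. -/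
def profileMeasure : Measure ℝ := Measure.map gaussianProfile volume

theorem measurePreserving_gaussianProfile :
    MeasurePreserving gaussianProfile volume profileMeasure :=
  ⟨measurable_gaussianProfile, rfl⟩

theorem ae_profileMeasure : ∀ᵐ z ∂profileMeasure, z ∈ Set.Ioc (0 : ℝ) 1 := by
  refine (ae_map_iff measurable_gaussianProfile.aemeasurable measurableSet_Ioc).mpr ?_
  refine Eventually.of_forall fun x => ⟨Real.exp_pos _, Real.exp_le_one_iff.mpr ?_⟩
  have := Real.pi_pos
  nlinarith [sq_nonneg ‖x‖]

theorem gaussianProfile_pow (k : ℕ) (x : Plane) :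
    ((gaussianProfile x : ℂ)) ^ (k + 1) = Complex.exp (-(Real.pi * (k + 1)) * ‖x‖ ^ 2) := by
  rw [gaussianProfile, Complex.ofReal_exp, ← Complex.exp_nat_mul]
  congr 1
  push_cast
  ring

theorem pi_mul_succ_re_pos (k : ℕ) : 0 < (Real.pi * (k + 1) : ℂ).re := by
  have h : (Real.pi * (k + 1) : ℂ) = ((Real.pi * (k + 1) : ℝ) : ℂ) := by push_cast; ring
  rw [h, Complex.ofReal_re]
  have := Real.pi_pos
  positivity

theorem memLp_pow_profileMeasure (k : ℕ) :
    MemLp (fun z : ℝ => (z : ℂ) ^ (k + 1)) 2 profileMeasure := by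
  rw [profileMeasure, memLp_map_measure_iff (by fun_prop) measurable_gaussianProfile.aemeasurable]
  refine (memLp_gaussian (pi_mul_succ_re_pos k)).ae_eq (Eventually.of_forall fun x => ?_)
  exact (gaussianProfile_pow k x).symm

/-- A square integrable function orthogonal to all positive powers vanishes: by the Weierstrass
theorem its product with `z` is orthogonal to all continuous functions. -/
theorem ae_eq_zero_of_integral_pow {φ : ℝ → ℂ} (hφ : MemLp φ 2 profileMeasure)
    (h : ∀ k : ℕ, ∫ z, (z : ℂ) ^ (k + 1) * φ z ∂profileMeasure = 0) :
    ∀ᵐ z ∂profileMeasure, φ z = 0 := by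
  set H : ℝ → ℂ := fun z => (z : ℂ) * φ z with hH
  have hHi : Integrable H profileMeasure := by
    have := (memLp_pow_profileMeasure 0).integrable_mul hφ
    refine this.congr (Eventually.of_forall fun z => ?_)
    simp [hH]
  have hpow : ∀ k : ℕ, Integrable (fun z : ℝ => (z : ℂ) ^ k * H z) profileMeasure := by
    intro k
    have := (memLp_pow_profileMeasure k).integrable_mul hφ
    refine this.congr (Eventually.of_forall fun z => ?_)
    simp only [hH, Pi.mul_apply]
    ring
  have hpoly : ∀ p : Polynomial ℝ, ∫ z, p.eval z • H z ∂profileMeasure = 0 := by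
    intro p
    have h1 : ∀ z, p.eval z • H z
        = ∑ k ∈ Finset.range (p.natDegree + 1), (p.coeff k : ℂ) * ((z : ℂ) ^ k * H z) := by
      intro z
      rw [Polynomial.eval_eq_sum_range, Finset.sum_smul]
      refine Finset.sum_congr rfl fun k _ => ?_
      rw [Complex.real_smul]
      push_cast
      ring
    simp only [h1]
    rw [integral_finsetSum _ fun k _ => (hpow k).const_mul _]
    refine Finset.sum_eq_zero fun k _ => ?_
    rw [integral_const_mul]
    have h2 : ∫ z, (z : ℂ) ^ k * H z ∂profileMeasure = 0 := by
      rw [← h k]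
      refine integral_congr_ae (Eventually.of_forall fun z => ?_)
      simp only [hH]
      ring
    rw [h2, mul_zero]
  have hpolyi : ∀ p : Polynomial ℝ, Integrable (fun z => p.eval z • H z) profileMeasure := by
    intro p
    have h1 : (fun z => p.eval z • H z)
        = fun z : ℝ => ∑ k ∈ Finset.range (p.natDegree + 1),
          (p.coeff k : ℂ) * ((z : ℂ) ^ k * H z) := by
      ext z
      rw [Polynomial.eval_eq_sum_range, Finset.sum_smul]
      refine Finset.sum_congr rfl fun k _ => ?_
      rw [Complex.real_smul]
      push_cast
      ring
    rw [h1]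
    exact integrable_finsetSum _ fun k _ => (hpow k).const_mul _
  have hH0 : ∀ᵐ z ∂profileMeasure, H z = 0 := by
    refine ae_eq_zero_of_integral_contDiff_smul_eq_zero hHi.locallyIntegrable fun g hg hgs => ?_
    rw [← norm_eq_zero]
    by_contra hne
    have hpos : 0 < ‖∫ z, g z • H z ∂profileMeasure‖ := lt_of_le_of_ne (norm_nonneg _) (Ne.symm hne)
    set I := ‖∫ z, g z • H z ∂profileMeasure‖ with hI
    set M := ∫ z, ‖H z‖ ∂profileMeasure with hM
    have hM0 : 0 ≤ M := integral_nonneg fun _ => norm_nonneg _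
    obtain ⟨p, hp⟩ := exists_polynomial_near_of_continuousOn 0 1 g hg.continuous.continuousOn
      (I / (2 * (M + 1))) (by positivity)
    have hgi : Integrable (fun z => g z • H z) profileMeasure := by
      obtain ⟨C, hC⟩ := hgs.exists_bound_of_continuous hg.continuous
      exact hHi.bdd_smul C hg.continuous.aestronglyMeasurable (Eventually.of_forall hC)
    have h0 : ∫ z, g z • H z ∂profileMeasure
        = ∫ z, (g z • H z - p.eval z • H z) ∂profileMeasure := by
      rw [integral_sub hgi (hpolyi p), hpoly p, sub_zero]
    have h1 : ‖∫ z, (g z • H z - p.eval z • H z) ∂profileMeasure‖ ≤ I / (2 * (M + 1)) * M := by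
      rw [hM, ← integral_const_mul]
      refine norm_integral_le_of_norm_le (hHi.norm.const_mul _) ?_
      filter_upwards [ae_profileMeasure] with z hz
      rw [← sub_smul, norm_smul, norm_sub_rev, Real.norm_eq_abs]
      exact mul_le_mul_of_nonneg_right (hp z ⟨hz.1.le, hz.2⟩).le (norm_nonneg _)
    rw [← h0, ← hI] at h1
    have h2 : I / (2 * (M + 1)) * M < I := by
      rw [div_mul_eq_mul_div, div_lt_iff₀ (by positivity)]
      nlinarith
    linarith
  filter_upwards [hH0, ae_profileMeasure] with z h1 h2
  exact (mul_eq_zero.mp h1).resolve_left (by exact_mod_cast h2.1.ne')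

theorem topologicalClosure_span_pow :
    (Submodule.span ℂ (Set.range fun k : ℕ =>
      ((memLp_pow_profileMeasure k).toLp _ : Lp ℂ 2 profileMeasure))).topologicalClosure = ⊤ := by
  rw [Submodule.topologicalClosure_eq_top_iff, Submodule.eq_bot_iff]
  intro φ hφ
  rw [Submodule.mem_orthogonal] at hφ
  rw [Lp.eq_zero_iff_ae_eq_zero]
  refine ae_eq_zero_of_integral_pow (Lp.memLp φ) fun k => ?_
  have h1 := hφ _ (Submodule.subset_span ⟨k, rfl⟩)
  rw [L2.inner_def] at h1
  rw [← h1]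
  refine integral_congr_ae ?_
  filter_upwards [(memLp_pow_profileMeasure k).coeFn_toLp] with z hz
  rw [hz, RCLike.inner_apply, map_pow, Complex.conj_ofReal, mul_comm]

/-- The span of the modes. -/
def modeSpan : Submodule ℂ L2Plane := Submodule.span ℂ (Set.range (modeLp 0))

theorem gaussianLp_mem_modeSpan (k : ℕ) :
    gaussianLp (pi_mul_succ_re_pos k) ∈ modeSpan.topologicalClosure := by
  -- the parameter `r` of the generating function with `(1 + r) / (1 - r) = k + 1`
  set r : ℝ := k / (k + 2) with hr
  have hk2 : (0 : ℝ) < k + 2 := by positivity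
  have hr1 : |r| < 1 := by
    rw [abs_of_nonneg (by positivity), hr, div_lt_one hk2]
    linarith
  have h1 : (∑' n, (r : ℂ) ^ n • modeLp 0 n : L2Plane) ∈ modeSpan.topologicalClosure :=
    mem_closure_of_tendsto (summable_smul_modeLp 0 hr1).hasSum (Eventually.of_forall fun A =>
      Submodule.sum_mem _ fun n _ => Submodule.smul_mem _ _ (Submodule.subset_span ⟨n, rfl⟩))
  rw [tsum_modeLp_eq_gaussianLp 0 hr1] at h1
  have h2 := Submodule.smul_mem _
    ((1 + (0 : ℝ) * Complex.I) - r * (1 - (0 : ℝ) * Complex.I) : ℂ) h1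
  rw [smul_smul, mul_inv_cancel₀ (evolvedGaussian_denom_ne_zero 0 hr1), one_smul] at h2
  convert! h2 using 1
  refine Lp.ext ?_
  filter_upwards [coeFn_gaussianLp (pi_mul_succ_re_pos k),
    coeFn_gaussianLp (evolvedGaussian_exponent_re_pos 0 hr1)] with x h3 h4
  rw [h3, h4]
  congr 3
  have h5 : (k + 2 : ℂ) ≠ 0 := by exact_mod_cast hk2.ne'
  simp only [Complex.ofReal_zero, zero_mul, add_zero, sub_zero, mul_one, hr]
  push_cast
  have h6 : (1 - k / (k + 2) : ℂ) = 2 / (k + 2) := by field_simp; ring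
  rw [h6]
  field_simp
  ring

/-- Every radial function is a limit of combinations of modes. -/
theorem mem_modeSpan_of_isRadial {f : L2Plane} (hf : IsRadial f) :
    f ∈ modeSpan.topologicalClosure := by
  obtain ⟨g, hg, hfg⟩ := hf
  -- `f` as a function of the Gaussian profile `z = exp (-π ‖x‖²)`
  set G : ℝ → ℂ := fun z => g (√(-Real.log z / Real.pi)) with hG
  have hGm : Measurable G := hg.comp (by fun_prop)
  have hGf : ∀ᵐ x, f x = G (gaussianProfile x) := by
    filter_upwards [hfg] with x hx
    rw [hx, hG]
    simp only [gaussianProfile, Real.log_exp]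
    rw [neg_mul, neg_neg, mul_div_cancel_left₀ _ Real.pi_ne_zero, Real.sqrt_sq (norm_nonneg x)]
  have hGL : MemLp G 2 profileMeasure := by
    rw [profileMeasure, memLp_map_measure_iff hGm.aestronglyMeasurable
      measurable_gaussianProfile.aemeasurable]
    exact (Lp.memLp f).ae_eq hGf
  set T := Lp.compMeasurePreservingₗᵢ (E := ℂ) (p := 2) ℂ gaussianProfile
    measurePreserving_gaussianProfile with hT
  have hTf : T (hGL.toLp G) = f := by
    refine Lp.ext ?_
    have h1 : T (hGL.toLp G) = (hGL.comp_measurePreserving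
      measurePreserving_gaussianProfile).toLp _ := rfl
    rw [h1]
    filter_upwards [(hGL.comp_measurePreserving
      measurePreserving_gaussianProfile).coeFn_toLp, hGf] with x h2 h3
    rw [h2, h3, Function.comp_apply]
  have hmem : hGL.toLp G ∈ (Submodule.span ℂ (Set.range fun k : ℕ =>
      ((memLp_pow_profileMeasure k).toLp _ : Lp ℂ 2 profileMeasure))).topologicalClosure := by
    rw [topologicalClosure_span_pow]
    trivial
  rw [← hTf]
  refine Submodule.topologicalClosure_minimal (t := modeSpan.topologicalClosure.comap
    T.toLinearMap) _ ?_ (modeSpan.isClosed_topologicalClosure.preimage T.continuous) hmem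
  rw [Submodule.span_le]
  rintro _ ⟨k, rfl⟩
  change T ((memLp_pow_profileMeasure k).toLp _) ∈ modeSpan.topologicalClosure
  convert! gaussianLp_mem_modeSpan k using 1
  refine Lp.ext ?_
  have h1 : T ((memLp_pow_profileMeasure k).toLp _) = ((memLp_pow_profileMeasure
    k).comp_measurePreserving measurePreserving_gaussianProfile).toLp _ := rfl
  rw [h1]
  filter_upwards [((memLp_pow_profileMeasure k).comp_measurePreserving
    measurePreserving_gaussianProfile).coeFn_toLp, coeFn_gaussianLp (pi_mul_succ_re_pos k)]
    with x h2 h3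
  rw [h2, h3, Function.comp_apply, gaussianProfile_pow]

/-! ### Expansions in modes -/

theorem orthonormal_modeLp (s : ℝ) : Orthonormal ℂ fun n => ((√2 : ℝ) : ℂ) • modeLp s n := by
  rw [orthonormal_iff_ite]
  intro m n
  rw [inner_smul_left, inner_smul_right, inner_modeLp, Complex.conj_ofReal, ← mul_assoc,
    ← Complex.ofReal_mul, Real.mul_self_sqrt two_pos.le]
  split_ifs <;> simp

theorem hasLaguerreExpansion_iff (f : L2Plane) (α : ℕ → ℂ) :
    HasLaguerreExpansion f α ↔
      Tendsto (fun N => ∑ n ∈ Finset.range N, α n • modeLp 0 n) atTop (𝓝 f) := by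
  rw [Lp.tendsto_Lp_iff_tendsto_eLpNorm', HasLaguerreExpansion]
  refine tendsto_congr fun N => ?_
  rw [eLpNorm_sub_comm]
  refine eLpNorm_congr_ae ?_
  filter_upwards [coeFn_sum_smul_modeLp 0 α (Finset.range N)] with x hx
  rw [Pi.sub_apply, hx]
  simp only [evolvedMode_zero]

theorem inner_modeLp_sum (s : ℝ) (α : ℕ → ℂ) (A : Finset ℕ) (m : ℕ) :
    inner ℂ (modeLp s m) (∑ n ∈ A, α n • modeLp s n) = if m ∈ A then α m / 2 else 0 := by
  rw [inner_sum]
  simp only [inner_smul_right, inner_modeLp]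
  simp [div_eq_mul_inv]

/-- The coefficients of an expansion are determined by inner products with the modes. -/
theorem HasLaguerreExpansion.eq_inner {f : L2Plane} {α : ℕ → ℂ} (h : HasLaguerreExpansion f α)
    (m : ℕ) : α m = 2 * inner ℂ (modeLp 0 m) f := by
  rw [hasLaguerreExpansion_iff] at h
  have h1 : Tendsto (fun N => inner ℂ (modeLp 0 m) (∑ n ∈ Finset.range N, α n • modeLp 0 n)) atTop
      (𝓝 (inner ℂ (modeLp 0 m) f)) := tendsto_const_nhds.inner h
  have h2 : Tendsto (fun N => inner ℂ (modeLp 0 m) (∑ n ∈ Finset.range N, α n • modeLp 0 n)) atTop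
      (𝓝 (α m / 2)) := by
    refine tendsto_const_nhds.congr' ?_
    filter_upwards [eventually_gt_atTop m] with N hN
    rw [inner_modeLp_sum, if_pos (Finset.mem_range.mpr hN)]
  rw [tendsto_nhds_unique h1 h2]
  ring

theorem norm_sum_modeLp_sq (s : ℝ) (α : ℕ → ℂ) (A : Finset ℕ) :
    ‖∑ n ∈ A, α n • modeLp s n‖ ^ 2 = 1 / 2 * ∑ n ∈ A, ‖α n‖ ^ 2 := by
  have h := inner_self_eq_norm_sq_to_K (𝕜 := ℂ) (∑ n ∈ A, α n • modeLp s n)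
  rw [sum_inner] at h
  have h2 : ∀ m ∈ A, inner ℂ (α m • modeLp s m) (∑ n ∈ A, α n • modeLp s n)
      = ((1 / 2 * ‖α m‖ ^ 2 : ℝ) : ℂ) := by
    intro m hm
    rw [inner_smul_left, inner_modeLp_sum, if_pos hm, ← mul_div_assoc, mul_comm, Complex.mul_conj,
      Complex.normSq_eq_norm_sq]
    push_cast
    ring
  rw [Finset.sum_congr rfl h2, ← Complex.ofReal_sum, ← Finset.mul_sum] at h
  exact Complex.ofReal_injective (by push_cast at h ⊢; exact h.symm)

theorem HasLaguerreExpansion.hasSum_norm_sq {f : L2Plane} {α : ℕ → ℂ}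
    (h : HasLaguerreExpansion f α) : HasSum (fun n => ‖α n‖ ^ 2) (2 * ‖f‖ ^ 2) := by
  rw [hasLaguerreExpansion_iff] at h
  rw [hasSum_iff_tendsto_nat_of_nonneg fun _ => by positivity]
  have h1 := (h.norm.pow 2).const_mul 2
  refine h1.congr fun N => ?_
  rw [norm_sum_modeLp_sq]
  ring

theorem exists_hasLaguerreExpansion {f : L2Plane} (hf : IsRadial f) :
    ∃ α, HasLaguerreExpansion f α := by
  have hV := (orthonormal_modeLp 0).orthogonalFamily
  have h1 : f ∈ LinearMap.range hV.linearIsometry.toLinearMap := by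
    rw [hV.range_linearIsometry]
    refine Submodule.topologicalClosure_mono ?_ (mem_modeSpan_of_isRadial hf)
    rw [modeSpan, Submodule.span_le]
    rintro _ ⟨n, rfl⟩
    refine Submodule.mem_iSup_of_mem n ⟨((√2 : ℝ) : ℂ)⁻¹, ?_⟩
    change ((√2 : ℝ) : ℂ)⁻¹ • ((√2 : ℝ) : ℂ) • modeLp 0 n = modeLp 0 n
    rw [inv_smul_smul₀]
    simp
  obtain ⟨w, hw⟩ := h1
  refine ⟨fun n => w n * ((√2 : ℝ) : ℂ), ?_⟩
  rw [hasLaguerreExpansion_iff]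
  have h2 := (hV.hasSum_linearIsometry w).tendsto_sum_nat
  change hV.linearIsometry w = f at hw
  rw [hw] at h2
  refine h2.congr fun N => Finset.sum_congr rfl fun n _ => ?_
  rw [mul_smul]
  rfl

theorem existsUnique_hasLaguerreExpansion {f : L2Plane} (hf : IsRadial f) :
    ∃! α, HasLaguerreExpansion f α := by
  obtain ⟨α, hα⟩ := exists_hasLaguerreExpansion hf
  refine ⟨α, hα, fun β hβ => funext fun n => ?_⟩
  rw [hα.eq_inner, hβ.eq_inner]

/-! ### Space-time integrals of products of modes -/

theorem hasDerivAt_phase (s : ℝ) :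
    HasDerivAt phase (-2 * Complex.I / (1 + s * Complex.I) ^ 2) s := by
  have h1 : HasDerivAt (fun s : ℝ => (s : ℂ) * Complex.I) (1 * Complex.I) s :=
    (Complex.ofRealCLM.hasDerivAt (x := s)).mul_const _
  have h2 := (h1.const_sub 1).div (h1.const_add 1) (one_add_mul_I_ne_zero s)
  convert! h2 using 1
  ring

theorem norm_one_add_mul_I_ge (s : ℝ) : |s| ≤ ‖(1 + s * Complex.I : ℂ)‖ := by
  have := Complex.abs_im_le_norm (1 + s * Complex.I)
  simpa using this

theorem tendsto_phase {l : Filter ℝ} (hl : Tendsto (fun s : ℝ => |s|) l atTop) :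
    Tendsto phase l (𝓝 (-1)) := by
  have h1 : ∀ s, phase s = -1 + 2 * (1 + s * Complex.I)⁻¹ := by
    intro s
    have := one_add_mul_I_ne_zero s
    rw [phase]
    field_simp
    ring
  have h2 : Tendsto (fun s : ℝ => (1 + s * Complex.I : ℂ)⁻¹) l (𝓝 0) := by
    rw [tendsto_zero_iff_norm_tendsto_zero]
    simp only [norm_inv]
    exact (tendsto_atTop_mono norm_one_add_mul_I_ge hl).inv_tendsto_atTop
  rw [funext h1]
  simpa using (h2.const_mul 2).const_add (-1)

theorem continuous_phase : Continuous phase := by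
  have h1 : ∀ s : ℝ, (1 + s * Complex.I : ℂ) ≠ 0 := one_add_mul_I_ne_zero
  unfold phase
  fun_prop (disch := assumption)

theorem integrable_phase_zpow (k : ℤ) :
    Integrable fun s : ℝ => ((1 + s ^ 2)⁻¹ : ℝ) * phase s ^ k := by
  refine integrable_inv_one_add_sq.ofReal.mul_bdd (c := 1) ?_ (Eventually.of_forall fun s => ?_)
  · exact (continuous_phase.zpow₀ k fun s => Or.inl (phase_ne_zero s)).aestronglyMeasurable
  · rw [norm_zpow, norm_phase, one_zpow]

/-- The powers of the phase are orthogonal for the Cauchy distribution: under `s = tan θ` the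
phase is `exp (-2 i θ)`. -/
theorem integral_phase_zpow (k : ℤ) :
    ∫ s : ℝ, (((1 + s ^ 2)⁻¹ : ℝ) : ℂ) * phase s ^ k = if k = 0 then (Real.pi : ℂ) else 0 := by
  split_ifs with hk
  · subst hk
    simp only [zpow_zero, mul_one]
    rw [integral_complex_ofReal, integral_univ_inv_one_add_sq]
  -- for `k ≠ 0` the integrand is a constant times the derivative of `phase s ^ k`, which has the
  -- same limit at both ends
  · have hd : ∀ s : ℝ, HasDerivAt (fun s => phase s ^ k)
        (-2 * Complex.I * k * ((((1 + s ^ 2)⁻¹ : ℝ) : ℂ) * phase s ^ k)) s := by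
      intro s
      have h1 := (hasDerivAt_zpow k (phase s) (Or.inl (phase_ne_zero s))).comp s
        (hasDerivAt_phase s)
      convert! h1 using 1
      rw [zpow_sub_one₀ (phase_ne_zero s), Complex.ofReal_inv, ← one_add_mul_I_mul_one_sub_mul_I]
      have h2 := one_add_mul_I_ne_zero s
      have h3 := one_sub_mul_I_ne_zero s
      rw [show (phase s)⁻¹ = (1 + s * Complex.I) / (1 - s * Complex.I) by rw [phase, inv_div]]
      field_simp
    have hl : ∀ l : Filter ℝ, Tendsto (fun s : ℝ => |s|) l atTop →
        Tendsto (fun s => phase s ^ k) l (𝓝 ((-1) ^ k)) := fun l h =>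
      (tendsto_phase h).zpow₀ k (Or.inl (by simp))
    have h := integral_of_hasDerivAt_of_tendsto hd ((integrable_phase_zpow k).const_mul _)
      (hl _ tendsto_abs_atBot_atTop) (hl _ tendsto_abs_atTop_atTop)
    rw [integral_const_mul, sub_self] at h
    refine (mul_eq_zero.mp h).resolve_left ?_
    simp [hk]

/-- The common shape of a product of four evolved modes in space-time. -/
def productProfile (F : ℝ → ℝ) (k : ℤ) (z : ℝ × Plane) : ℂ :=
  (((1 + (4 * Real.pi * z.1) ^ 2)⁻¹ : ℝ) : ℂ) ^ 2 * phase (4 * Real.pi * z.1) ^ k *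
    (F (4 * Real.pi / (1 + (4 * Real.pi * z.1) ^ 2) * ‖z.2‖ ^ 2) : ℂ)

theorem continuous_productProfile {F : ℝ → ℝ} (hF : Continuous F) (k : ℤ) :
    Continuous (productProfile F k) := by
  have h1 : ∀ z : ℝ × Plane, (1 + (4 * Real.pi * z.1) ^ 2) ≠ 0 := fun z => by positivity
  have h2 : Continuous fun z : ℝ × Plane => phase (4 * Real.pi * z.1) ^ k :=
    (continuous_phase.comp (by fun_prop)).zpow₀ k fun s => Or.inl (phase_ne_zero _)
  unfold productProfile
  fun_prop (disch := assumption)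

theorem integral_productProfile_slice (F : ℝ → ℝ) (k : ℤ) (t : ℝ) :
    ∫ x, productProfile F k (t, x) = (1 / 4 * ∫ y in Set.Ioi (0 : ℝ), F y : ℝ) *
      ((((1 + (4 * Real.pi * t) ^ 2)⁻¹ : ℝ) : ℂ) * phase (4 * Real.pi * t) ^ k) := by
  simp only [productProfile]
  rw [integral_const_mul, integral_complex_ofReal, integral_radial F (by positivity)]
  have h1 : (((1 + (4 * Real.pi * t) ^ 2 : ℝ)) : ℂ) ≠ 0 := by
    exact_mod_cast (by positivity : (1 + (4 * Real.pi * t) ^ 2) ≠ 0)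
  have h2 : (Real.pi : ℂ) ≠ 0 := by exact_mod_cast Real.pi_ne_zero
  rw [smul_eq_mul]
  push_cast at h1 ⊢
  field_simp

theorem integrable_productProfile {F : ℝ → ℝ} (hF : Continuous F)
    (hFi : IntegrableOn F (Set.Ioi 0)) (k : ℤ) :
    Integrable (productProfile F k) (volume.prod volume) := by
  rw [integrable_prod_iff (continuous_productProfile hF k).aestronglyMeasurable]
  have hn : ∀ t x, ‖productProfile F k (t, x)‖ = ((1 + (4 * Real.pi * t) ^ 2)⁻¹) ^ 2 *
      |F (4 * Real.pi / (1 + (4 * Real.pi * t) ^ 2) * ‖x‖ ^ 2)| := by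
    intro t x
    rw [productProfile, norm_mul, norm_mul, norm_zpow, norm_phase, one_zpow, mul_one, norm_pow,
      Complex.norm_real, Complex.norm_real, Real.norm_eq_abs, Real.norm_eq_abs,
      abs_of_nonneg (by positivity : (0 : ℝ) ≤ (1 + (4 * Real.pi * t) ^ 2)⁻¹)]
  constructor
  · refine Eventually.of_forall fun t => ?_
    simp only [productProfile]
    exact (integrable_radial (by positivity) hFi).ofReal.const_mul _
  · simp only [hn]
    have h1 : ∀ t : ℝ, ∫ x : Plane, ((1 + (4 * Real.pi * t) ^ 2)⁻¹) ^ 2 *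
        |F (4 * Real.pi / (1 + (4 * Real.pi * t) ^ 2) * ‖x‖ ^ 2)|
        = (1 / 4 * ∫ y in Set.Ioi (0 : ℝ), |F y|) * (1 + (4 * Real.pi * t) ^ 2)⁻¹ := by
      intro t
      rw [integral_const_mul, integral_radial (fun y => |F y|) (by positivity), smul_eq_mul]
      have h2 : (1 + (4 * Real.pi * t) ^ 2) ≠ 0 := by positivity
      have := Real.pi_ne_zero
      field_simp
    simp only [h1]
    exact (integrable_inv_one_add_sq.comp_mul_left' (by positivity)).const_mul _

theorem integral_productProfile {F : ℝ → ℝ} (hF : Continuous F)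
    (hFi : IntegrableOn F (Set.Ioi 0)) (k : ℤ) :
    ∫ z, productProfile F k z ∂(volume.prod volume)
      = if k = 0 then ((1 / 16 * ∫ y in Set.Ioi (0 : ℝ), F y : ℝ) : ℂ) else 0 := by
  rw [integral_prod _ (integrable_productProfile hF hFi k)]
  simp only [integral_productProfile_slice]
  rw [integral_const_mul, Measure.integral_comp_mul_left
    (fun s : ℝ => (((1 + s ^ 2)⁻¹ : ℝ) : ℂ) * phase s ^ k), integral_phase_zpow]
  split_ifs with h
  · have h2 : (Real.pi : ℂ) ≠ 0 := by exact_mod_cast Real.pi_ne_zero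
    rw [abs_of_nonneg (by positivity), Complex.real_smul]
    push_cast
    field_simp
    ring
  · simp

/-- The `n`-th evolved mode as a function on space-time. -/
def spacetimeMode (n : ℕ) (z : ℝ × Plane) : ℂ := evolvedMode (4 * Real.pi * z.1) n z.2

theorem continuous_spacetimeMode (n : ℕ) : Continuous (spacetimeMode n) := by
  have h : Continuous fun z : ℝ × Plane => (4 * Real.pi * z.1, z.2) := by fun_prop
  have h2 := (continuous_evolvedMode n).comp h
  exact h2

/-- The integrand in the definition of `coeffQ`. -/
def coeffIntegrand (a b c d : ℕ) (x : ℝ) : ℝ :=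
  laguerre a (x / 2) * laguerre b (x / 2) * laguerre c (x / 2) * laguerre d (x / 2)
      * Real.exp (-x)

theorem continuous_coeffIntegrand (a b c d : ℕ) : Continuous (coeffIntegrand a b c d) := by
  have := continuous_laguerre
  unfold coeffIntegrand
  fun_prop

theorem integrableOn_coeffIntegrand (a b c d : ℕ) :
    IntegrableOn (coeffIntegrand a b c d) (Set.Ioi 0) := by
  have := integrableOn_eval_mul_exp_neg
    ((laguerrePoly a * laguerrePoly b * laguerrePoly c * laguerrePoly d).comp
      (Polynomial.C (1 / 2) * Polynomial.X))
  refine this.congr_fun (fun x _ => ?_) measurableSet_Ioi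
  simp only [Polynomial.eval_comp, Polynomial.eval_mul, eval_laguerrePoly, Polynomial.eval_C,
    Polynomial.eval_X, coeffIntegrand]
  rw [show 1 / 2 * x = x / 2 by ring]

theorem spacetimeMode_product (a b c d : ℕ) (z : ℝ × Plane) :
    spacetimeMode a z * spacetimeMode b z * conj (spacetimeMode c z * spacetimeMode d z)
      = productProfile (coeffIntegrand a b c d) (((a : ℤ) - c) + (b - d)) z := by
  have h1 : spacetimeMode a z * spacetimeMode b z * conj (spacetimeMode c z * spacetimeMode d z)
      = (spacetimeMode a z * conj (spacetimeMode c z)) *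
        (spacetimeMode b z * conj (spacetimeMode d z)) := by
    rw [map_mul]
    ring
  rw [h1, spacetimeMode, spacetimeMode, spacetimeMode, spacetimeMode, evolvedMode_mul_conj,
    evolvedMode_mul_conj, productProfile, zpow_add₀ (phase_ne_zero _), coeffIntegrand]
  set y := 2 * Real.pi / (1 + (4 * Real.pi * z.1) ^ 2) * ‖z.2‖ ^ 2 with hy
  rw [show 4 * Real.pi / (1 + (4 * Real.pi * z.1) ^ 2) * ‖z.2‖ ^ 2 = 2 * y by rw [hy]; ring,
    mul_div_cancel_left₀ y two_ne_zero, show -(2 * y) = -y + -y by ring, Real.exp_add]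
  push_cast
  ring

theorem integrable_spacetimeMode_product (a b c d : ℕ) :
    Integrable (fun z => spacetimeMode a z * spacetimeMode b z *
      conj (spacetimeMode c z * spacetimeMode d z)) (volume.prod volume) := by
  simp only [spacetimeMode_product]
  exact integrable_productProfile (continuous_coeffIntegrand a b c d)
    (integrableOn_coeffIntegrand a b c d) _

theorem integral_spacetimeMode_product (a b c d : ℕ) :
    ∫ z, spacetimeMode a z * spacetimeMode b z *
      conj (spacetimeMode c z * spacetimeMode d z) ∂(volume.prod volume)
      = if a + b = c + d then ((1 / 16 * coeffQ a b c d : ℝ) : ℂ) else 0 := by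
  simp only [spacetimeMode_product]
  rw [integral_productProfile (continuous_coeffIntegrand a b c d)
    (integrableOn_coeffIntegrand a b c d)]
  exact if_congr (by omega) rfl rfl

/-! ### The `L⁴` norm of the evolution -/

/-- The restriction to `A × A` of the family `α a * α b`. -/
def tensorSq (α : ℕ → ℂ) (A : Finset ℕ) : PairSeq :=
  ∑ p ∈ A ×ˢ A, lp.single 2 p (α p.1 * α p.2)

theorem tensorSq_apply (α : ℕ → ℂ) (A : Finset ℕ) (q : ℕ × ℕ) :
    tensorSq α A q = if q ∈ A ×ˢ A then α q.1 * α q.2 else 0 := by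
  have h : ∀ s : Finset (ℕ × ℕ), (∑ p ∈ s, lp.single 2 p (α p.1 * α p.2) : PairSeq) q
      = if q ∈ s then α q.1 * α q.2 else 0 := by
    intro s
    rw [lp.coeFn_sum, Finset.sum_apply]
    simp only [lp.single_apply, Pi.single_apply]
    rw [Finset.sum_ite_eq s q fun p => α p.1 * α p.2]
  exact h _

theorem norm_tensorSq_sq (α : ℕ → ℂ) (A : Finset ℕ) :
    ‖tensorSq α A‖ ^ 2 = (∑ n ∈ A, ‖α n‖ ^ 2) ^ 2 := by
  have h1 := hasSum_norm_sq (tensorSq α A)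
  have h2 : HasSum (fun p => ‖tensorSq α A p‖ ^ 2) (∑ p ∈ A ×ˢ A, ‖tensorSq α A p‖ ^ 2) := by
    refine hasSum_sum_of_ne_finset_zero fun p hp => ?_
    rw [tensorSq_apply, if_neg hp]
    simp
  rw [h1.unique h2, sq (∑ n ∈ A, ‖α n‖ ^ 2), Finset.sum_mul_sum, ← Finset.sum_product']
  refine Finset.sum_congr rfl fun p hp => ?_
  rw [tensorSq_apply, if_pos hp, norm_mul, mul_pow]

theorem inner_pairOperator_tensorSq (α : ℕ → ℂ) (A : Finset ℕ) :
    inner ℂ (pairOperator (tensorSq α A)) (tensorSq α A)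
      = ∑ p ∈ A ×ˢ A, ∑ q ∈ A ×ˢ A, if p.1 + p.2 = q.1 + q.2 then
          α p.1 * α p.2 * conj (α q.1 * α q.2) * (coeffQ p.1 p.2 q.1 q.2 : ℂ) else 0 := by
  have h1 := hasSum_inner_pairOperator (tensorSq α A)
  have h2 : HasSum (fun p => tensorSq α A p * conj (applyQ (tensorSq α A) p))
      (∑ p ∈ A ×ˢ A, tensorSq α A p * conj (applyQ (tensorSq α A) p)) := by
    refine hasSum_sum_of_ne_finset_zero fun p hp => ?_
    rw [tensorSq_apply, if_neg hp, zero_mul]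
  rw [h1.unique h2]
  refine Finset.sum_congr rfl fun p hp => ?_
  rw [tensorSq_apply, if_pos hp, applyQ, map_sum, Finset.mul_sum]
  have h3 : ∀ q, (q ∈ Finset.HasAntidiagonal.antidiagonal (p.1 + p.2) ∧ q ∈ A ×ˢ A) ↔
      (q ∈ A ×ˢ A ∧ p.1 + p.2 = q.1 + q.2) := fun q => by
    rw [Finset.HasAntidiagonal.mem_antidiagonal, and_comm, eq_comm]
  rw [← Finset.sum_filter]
  have h4 : ∀ q, α p.1 * α p.2 * conj (tensorSq α A q * (coeffQ p.1 p.2 q.1 q.2 : ℂ))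
      = if q ∈ A ×ˢ A then
        α p.1 * α p.2 * conj (α q.1 * α q.2) * (coeffQ p.1 p.2 q.1 q.2 : ℂ) else 0 := by
    intro q
    rw [tensorSq_apply]
    split_ifs
    · rw [map_mul, Complex.conj_ofReal]
      ring
    · simp
  simp only [h4]
  rw [← Finset.sum_filter]
  refine Finset.sum_congr ?_ fun _ _ => rfl
  ext q
  rw [Finset.mem_filter, Finset.mem_filter, h3]

theorem norm_sum_spacetimeMode_pow (α : ℕ → ℂ) (A : Finset ℕ) (z : ℝ × Plane) :
    ((‖∑ n ∈ A, α n * spacetimeMode n z‖ ^ 4 : ℝ) : ℂ)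
      = ∑ p ∈ A ×ˢ A, ∑ q ∈ A ×ˢ A, α p.1 * α p.2 * conj (α q.1 * α q.2) *
        (spacetimeMode p.1 z * spacetimeMode p.2 z *
          conj (spacetimeMode q.1 z * spacetimeMode q.2 z)) := by
  set u := ∑ n ∈ A, α n * spacetimeMode n z with hu
  have h1 : ((‖u‖ ^ 4 : ℝ) : ℂ) = (u * u) * conj (u * u) := by
    rw [Complex.mul_conj, Complex.normSq_eq_norm_sq, norm_mul]
    push_cast
    ring
  have h2 : u * u = ∑ p ∈ A ×ˢ A, α p.1 * α p.2 * (spacetimeMode p.1 z * spacetimeMode p.2 z) := by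
    rw [hu, Finset.sum_mul_sum, ← Finset.sum_product']
    refine Finset.sum_congr rfl fun p _ => ?_
    ring
  rw [h1, h2, map_sum, Finset.sum_mul_sum]
  refine Finset.sum_congr rfl fun p _ => Finset.sum_congr rfl fun q _ => ?_
  rw [map_mul]
  ring

theorem integrable_norm_sum_spacetimeMode_pow (α : ℕ → ℂ) (A : Finset ℕ) :
    Integrable (fun z => ((‖∑ n ∈ A, α n * spacetimeMode n z‖ ^ 4 : ℝ) : ℂ))
      (volume.prod volume) := by
  simp only [norm_sum_spacetimeMode_pow]
  exact integrable_finsetSum _ fun p _ => integrable_finsetSum _ fun q _ =>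
    (integrable_spacetimeMode_product _ _ _ _).const_mul _

/-- The `L⁴` norm of the evolution of a finite combination of modes. -/
theorem integral_norm_sum_spacetimeMode_pow (α : ℕ → ℂ) (A : Finset ℕ) :
    ((∫ z, ‖∑ n ∈ A, α n * spacetimeMode n z‖ ^ 4 ∂(volume.prod volume) : ℝ) : ℂ)
      = 1 / 16 * inner ℂ (pairOperator (tensorSq α A)) (tensorSq α A) := by
  rw [← integral_complex_ofReal]
  simp only [norm_sum_spacetimeMode_pow]
  rw [integral_finsetSum _ fun p _ => integrable_finsetSum _ fun q _ =>
    (integrable_spacetimeMode_product _ _ _ _).const_mul _, inner_pairOperator_tensorSq,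
    Finset.mul_sum]
  refine Finset.sum_congr rfl fun p _ => ?_
  rw [integral_finsetSum _ fun q _ => (integrable_spacetimeMode_product _ _ _ _).const_mul _,
    Finset.mul_sum]
  refine Finset.sum_congr rfl fun q _ => ?_
  rw [integral_const_mul, integral_spacetimeMode_product]
  split_ifs
  · push_cast
    ring
  · simp

theorem memLp_sum_spacetimeMode (α : ℕ → ℂ) (A : Finset ℕ) :
    MemLp (fun z => ∑ n ∈ A, α n * spacetimeMode n z) 4 (volume.prod volume) := by
  have hc : Continuous fun z => ∑ n ∈ A, α n * spacetimeMode n z :=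
    continuous_finsetSum _ fun n _ => continuous_const.mul (continuous_spacetimeMode n)
  rw [← integrable_norm_rpow_iff hc.aestronglyMeasurable (by norm_num) (by norm_num)]
  have := (integrable_norm_sum_spacetimeMode_pow α A).re
  refine this.congr (Eventually.of_forall fun z => ?_)
  simp only [RCLike.re_to_complex, Complex.ofReal_re]
  norm_num

instance fact_one_le_four : Fact ((1 : ENNReal) ≤ 4) := ⟨by norm_num⟩

/-- The space of functions on space-time with integrable fourth power. -/
abbrev L4SpaceTime : Type := Lp ℂ 4 ((volume : Measure ℝ).prod (volume : Measure Plane))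

/-- The space-time mode as an element of `L⁴`. -/
def modeL4 (n : ℕ) : L4SpaceTime :=
  (by simpa using memLp_sum_spacetimeMode 1 {n} :
    MemLp (spacetimeMode n) 4 (volume.prod volume)).toLp _

theorem coeFn_modeL4 (n : ℕ) : modeL4 n =ᵐ[volume.prod volume] spacetimeMode n :=
  MemLp.coeFn_toLp _

theorem coeFn_sum_modeL4 (α : ℕ → ℂ) (A : Finset ℕ) :
    (∑ n ∈ A, α n • modeL4 n : L4SpaceTime)
      =ᵐ[volume.prod volume] fun z => ∑ n ∈ A, α n * spacetimeMode n z := by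
  have h1 := Lp.coeFn_finsetSum A fun n => α n • modeL4 n
  have h2 : ∀ᵐ z ∂((volume : Measure ℝ).prod (volume : Measure Plane)), ∀ n,
      (α n • modeL4 n : L4SpaceTime) z
        = α n * spacetimeMode n z := by
    rw [ae_all_iff]
    intro n
    filter_upwards [Lp.coeFn_smul (α n) (modeL4 n), coeFn_modeL4 n] with x h3 h4
    rw [h3, Pi.smul_apply, h4, smul_eq_mul]
  filter_upwards [h1, h2] with x h3 h4
  rw [h3]
  simp [h4]

theorem norm_sum_modeL4_pow (α : ℕ → ℂ) (A : Finset ℕ) :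
    ((‖∑ n ∈ A, α n • modeL4 n‖ ^ 4 : ℝ) : ℂ)
      = 1 / 16 * inner ℂ (pairOperator (tensorSq α A)) (tensorSq α A) := by
  rw [← integral_norm_sum_spacetimeMode_pow]
  congr 1
  rw [Lp.norm_def, eLpNorm_congr_ae (coeFn_sum_modeL4 α A),
    (memLp_sum_spacetimeMode α A).eLpNorm_eq_integral_rpow_norm (by norm_num) (by norm_num),
    ENNReal.toReal_ofReal (by positivity)]
  have h0 : 0 ≤ ∫ z, ‖∑ n ∈ A, α n * spacetimeMode n z‖ ^ 4 ∂(volume.prod volume) :=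
    integral_nonneg fun _ => by positivity
  have h1 := Real.rpow_inv_natCast_pow h0 (n := 4) (by norm_num)
  simpa using h1

/-- The Strichartz estimate for finite combinations of modes. -/
theorem norm_sum_modeL4_sq_le (α : ℕ → ℂ) (A : Finset ℕ) :
    ‖∑ n ∈ A, α n • modeL4 n‖ ^ 2 ≤ 1 / 4 * ∑ n ∈ A, ‖α n‖ ^ 2 := by
  have h1 : ‖∑ n ∈ A, α n • modeL4 n‖ ^ 4 ≤ 1 / 16 * (∑ n ∈ A, ‖α n‖ ^ 2) ^ 2 := by
    have h2 := congrArg norm (norm_sum_modeL4_pow α A)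
    rw [Complex.norm_real, Real.norm_of_nonneg (by positivity), norm_mul] at h2
    rw [h2, ← norm_tensorSq_sq]
    have h3 : ‖inner ℂ (pairOperator (tensorSq α A)) (tensorSq α A)‖ ≤ ‖tensorSq α A‖ ^ 2 := by
      refine (norm_inner_le_norm _ _).trans ?_
      have := pairOperator.le_opNorm (tensorSq α A)
      rw [norm_pairOperator, one_mul] at this
      rw [sq]
      gcongr
    have h4 : ‖(1 / 16 : ℂ)‖ = 1 / 16 := by norm_num
    rw [h4]
    gcongr
  refine le_of_sq_le_sq ?_ (by positivity)
  calc _ = ‖∑ n ∈ A, α n • modeL4 n‖ ^ 4 := by ring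
    _ ≤ _ := h1
    _ = _ := by ring

theorem summable_modeL4 {α : ℕ → ℂ} (hα : Summable fun n => ‖α n‖ ^ 2) :
    Summable fun n => α n • modeL4 n := by
  rw [summable_iff_vanishing_norm] at hα ⊢
  intro ε hε
  obtain ⟨s, hs⟩ := hα (4 * ε ^ 2) (by positivity)
  refine ⟨s, fun t ht => ?_⟩
  have h1 := hs t ht
  rw [Real.norm_of_nonneg (Finset.sum_nonneg fun _ _ => by positivity)] at h1
  have h2 := norm_sum_modeL4_sq_le α t
  exact lt_of_pow_lt_pow_left₀ 2 hε.le (by linarith)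

/-- The square summable family `α a * α b`. -/
def tensorPair {α : ℕ → ℂ} (hα : Summable fun n => ‖α n‖ ^ 2) : PairSeq :=
  ⟨fun p => α p.1 * α p.2, by
    refine (memℓp_gen_iff (by norm_num)).mpr ?_
    simpa [mul_pow] using hα.mul_of_nonneg hα (fun _ => by positivity) fun _ => by positivity⟩

theorem tensorPair_apply {α : ℕ → ℂ} (hα : Summable fun n => ‖α n‖ ^ 2) (p : ℕ × ℕ) :
    tensorPair hα p = α p.1 * α p.2 := rfl

theorem norm_tensorPair_sq {α : ℕ → ℂ} (hα : Summable fun n => ‖α n‖ ^ 2) :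
    ‖tensorPair hα‖ ^ 2 = (∑' n, ‖α n‖ ^ 2) ^ 2 := by
  have h1 := hasSum_norm_sq (tensorPair hα)
  simp only [tensorPair_apply, norm_mul, mul_pow] at h1
  have h2 := hα.hasSum.mul hα.hasSum
    (hα.mul_of_nonneg hα (fun _ => by positivity) fun _ => by positivity)
  rw [h1.unique h2, sq]

theorem tendsto_tensorSq {α : ℕ → ℂ} (hα : Summable fun n => ‖α n‖ ^ 2) :
    Tendsto (fun N => tensorSq α (Finset.range N)) atTop (𝓝 (tensorPair hα)) := by
  have h1 := lp.hasSum_single (p := 2) (by norm_num) (tensorPair hα)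
  have h2 : Tendsto (fun N : ℕ => Finset.range N ×ˢ Finset.range N) atTop atTop := by
    refine tendsto_atTop_finset_of_monotone (fun M N h => ?_) fun p => ⟨max p.1 p.2 + 1, ?_⟩
    · exact Finset.product_subset_product (Finset.range_subset_range.mpr h)
        (Finset.range_subset_range.mpr h)
    · rw [Finset.mem_product, Finset.mem_range, Finset.mem_range]
      omega
  exact h1.comp h2

theorem norm_tsum_modeL4_pow {α : ℕ → ℂ} (hα : Summable fun n => ‖α n‖ ^ 2) :
    (‖∑' n, α n • modeL4 n‖ : ℂ) ^ 4
      = 1 / 16 * inner ℂ (pairOperator (tensorPair hα)) (tensorPair hα) := by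
  have h1 := (Complex.continuous_ofReal.tendsto _).comp
    ((summable_modeL4 hα).hasSum.tendsto_sum_nat.norm.pow 4)
  have h2 := (((pairOperator.continuous.tendsto _).comp (tendsto_tensorSq hα)).inner
    (𝕜 := ℂ) (tendsto_tensorSq hα)).const_mul (1 / 16 : ℂ)
  have h3 := tendsto_nhds_unique (h1.congr fun N => norm_sum_modeL4_pow α _) h2
  rw [← h3]
  push_cast
  rfl

/-- The sum of the space-time modes represents the evolution: along a subsequence the partial sums
converge almost everywhere in space-time, while on each time slice they converge in `L²`. -/
theorem isEvolution_tsum_modeL4 {f : L2Plane} {α : ℕ → ℂ} (h : HasLaguerreExpansion f α) :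
    IsEvolution f (∑' n, α n • modeL4 n : L4SpaceTime) := by
  refine ⟨Lp.aestronglyMeasurable _, ?_⟩
  have hs := (summable_modeL4 h.hasSum_norm_sq.summable).hasSum.tendsto_sum_nat
  obtain ⟨ns, hns, h2⟩ := (tendstoInMeasure_of_tendsto_Lp hs).exists_seq_tendsto_ae
  have h3 : ∀ᵐ z ∂((volume : Measure ℝ).prod (volume : Measure Plane)), ∀ N,
      (∑ n ∈ Finset.range N, α n • modeL4 n : L4SpaceTime) z
        = ∑ n ∈ Finset.range N, α n * spacetimeMode n z := by
    rw [ae_all_iff]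
    exact fun N => coeFn_sum_modeL4 α _
  filter_upwards [Measure.ae_ae_of_ae_prod h2, Measure.ae_ae_of_ae_prod h3] with t h4 h5
  rw [hasLaguerreExpansion_iff] at h
  have h6 : Tendsto (fun k => ∑ n ∈ Finset.range (ns k), α n • modeLp (4 * Real.pi * t) n) atTop
      (𝓝 (schrodingerFlow t f)) := by
    have h7 := ((flowIsometry t).continuous.tendsto f).comp (h.comp hns.tendsto_atTop)
    refine h7.congr fun k => ?_
    simp only [Function.comp_apply, map_sum, map_smul, flowIsometry_modeLp]
  refine (ae_eq_of_tendsto_of_ae_tendsto h6 ?_).symm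
  have h8 : ∀ᵐ x, ∀ N, (∑ n ∈ Finset.range N, α n • modeLp (4 * Real.pi * t) n : L2Plane) x
      = ∑ n ∈ Finset.range N, α n * evolvedMode (4 * Real.pi * t) n x := by
    rw [ae_all_iff]
    exact fun N => coeFn_sum_smul_modeLp _ α _
  filter_upwards [h4, h5, h8] with x h9 h10 h11
  simp only [h10] at h9
  simp only [h11]
  exact h9

/-- Two representatives of the same evolution agree almost everywhere in space-time. -/
theorem IsEvolution.ae_eq {f : L2Plane} {u v : ℝ × Plane → ℂ} (hu : IsEvolution f u)
    (hv : IsEvolution f v) : u =ᵐ[volume.prod volume] v := by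
  obtain ⟨hum, hu⟩ := hu
  obtain ⟨hvm, hv⟩ := hv
  have h1 : ∀ᵐ z ∂((volume : Measure ℝ).prod (volume : Measure Plane)),
      z ∈ {z | hum.mk u z = hvm.mk v z} := by
    rw [Measure.ae_prod_mem_iff_ae_ae_mem (measurableSet_eq_fun
      hum.stronglyMeasurable_mk.measurable hvm.stronglyMeasurable_mk.measurable)]
    filter_upwards [hu, hv, Measure.ae_ae_of_ae_prod hum.ae_eq_mk,
      Measure.ae_ae_of_ae_prod hvm.ae_eq_mk] with t h1 h2 h3 h4
    filter_upwards [h1, h2, h3, h4] with x h5 h6 h7 h8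
    rw [← h7, ← h8, h5, h6]
  filter_upwards [h1, hum.ae_eq_mk, hvm.ae_eq_mk] with z h2 h3 h4
  rw [h3, h4]
  exact h2

end

end LaguerreStrichartz

open LaguerreStrichartz MeasureTheory
/-- Mathlib's `inner ℂ x y` is conjugate linear in `x`, so that `inner ℂ (Q φ) φ` is
`∑ φ(a,b) * conj (Qφ(a,b))`. -/
theorem mainTheorem3 :
    ∃ Q : PairSeq →L[ℂ] PairSeq,
      (∀ (φ : PairSeq) (p : ℕ × ℕ), Q φ p = applyQ φ p) ∧
      (∀ f : L2Plane, IsRadial f →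
        (∃! α : ℕ → ℂ, HasLaguerreExpansion f α) ∧
        ∀ α : ℕ → ℂ, HasLaguerreExpansion f α →
          ∃ φ : PairSeq, (∀ a b : ℕ, φ (a, b) = α a * α b) ∧
            (∃ u : ℝ × Plane → ℂ, IsEvolution f u) ∧
            (∀ u : ℝ × Plane → ℂ, IsEvolution f u →
              MemLp u 4 (volume.prod volume) ∧
              (((eLpNorm u 4 (volume.prod volume)).toReal : ℂ)) ^ 4
                = 1 / 16 * inner ℂ (Q φ) φ) ∧
            ((2 : ℝ) ^ (-(1 / 2) : ℝ) * ‖f‖) ^ 4 = 1 / 16 * ‖φ‖ ^ 2) ∧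
      (∀ S : ℕ, (blockQ S).PosSemidef ∧
        blockQ S ∈ doublyStochastic ℝ (Fin (S + 1)) ∧
        ∀ a c : Fin (S + 1), 0 < blockQ S a c) ∧
      ‖Q‖ = 1 ∧
      (∀ φ : PairSeq, inner ℂ (Q φ) φ = (‖φ‖ : ℂ) ^ 2 ↔
        ∀ a b c d : ℕ, a + b = c + d → φ (a, b) = φ (c, d)) := by
  refine ⟨pairOperator, pairOperator_apply, fun f hf => ⟨existsUnique_hasLaguerreExpansion hf,
    fun α hα => ?_⟩, fun S => ⟨blockQ_posSemidef S, blockQ_mem_doublyStochastic S, blockQ_pos S⟩,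
    norm_pairOperator, inner_pairOperator_eq_iff⟩
  have hs := hα.hasSum_norm_sq
  have hev := isEvolution_tsum_modeL4 hα
  refine ⟨tensorPair hs.summable, fun _ _ => rfl, ⟨_, hev⟩, fun u hu => ?_, ?_⟩
  · have h1 := hu.ae_eq hev
    refine ⟨(Lp.memLp _).ae_eq h1.symm, ?_⟩
    rw [eLpNorm_congr_ae h1, ← Lp.norm_def, norm_tsum_modeL4_pow]
  · rw [norm_tensorPair_sq, hs.tsum_eq]
    have h2 : ((2 : ℝ) ^ (-(1 / 2) : ℝ)) ^ 4 = 1 / 4 := by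
      rw [← Real.rpow_natCast, ← Real.rpow_mul two_pos.le]
      norm_num
    rw [mul_pow, h2]
    ring
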